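/- **Definitions.** For $r>0$ let $\mathcal B_r$ be the class of Borel sets $B\subset\mathbb R$ with $B\cap(-r,r)=\emptyset$, and $\mathcal B_0=\bigcup_{r>0}\mathcal B_r$. Let $\nu:\mathcal B_0\to\mathbb R$ be a function whose restriction to each $\mathcal B_r$ is a finite signed measure. Its positive part $\nu^+$, negative part $\nu^-$ and total variation $|\nu|$ are the unique measures on $\mathbb R$ that do not charge $\{0\}$ and coincide on each $\mathcal B_r$ with the positive part, negative part and total variation of $\nu|_{\mathcal B_r}$. If $\int_{\mathbb R}(1\wedge x^2)\,|\nu|(dx)<\infty$, then $\nu$ is called a quasi-Lévy type measure, and $\int f\,d\nu=\int f\,d\nu^+-\int f\,d\nu^-$. Let $\hat\mu(z)=\int_{\mathbb R}e^{ixz}\,\mu(dx)$ be the characteristic function of $\mu$. A probability measure $\mu$ on $\mathbb R$ is quasi-infinitely divisible (QID) with characteristic triplet $(a,\gamma,\nu)$, where $a,\gamma\in\mathbb R$ and $\nu$ is a quasi-Lévy type measure, if $$\hat\mu(z)=\exp\Big(-\tfrac12az^2+i\gamma z+\int_{\mathbb R}\big(e^{ixz}-1-ixz\mathbf 1_{[-1,1]}(x)\big)\,\nu(dx)\Big)\qquad\text{for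 all }z\in\mathbb R;$$ $\nu$ is then called the quasi-Lévy measure of $\mu$. The index of a nowhere vanishing $F:\mathbb R\to\mathbb C$ is $\frac1{2\pi}\big(\lim_{z\to+\infty}g(z)-\lim_{z\to-\infty}g(z)\big)$, where $g:\mathbb R\to\mathbb R$ is continuous with $F/|F|=e^{ig}$ and both limits exist. **Statement.** Let $\mu=\frac1{1000}\delta_0+\frac{999}{1000}N(1,1)$, where $N(1,1)$ is the normal distribution with mean $1$ and variance $1$. Then: 1. $\mu$ is a probability measure, and $\hat\mu(z)=\frac1{1000}+\frac{999}{1000}e^{iz}e^{-z^2/2}\neq0$ for all $z\in\mathbb R$. 2. $\hat\mu$ has index $2$. 3. $\mu$ is quasi-infinitely divisible, and for every characteristic triplet $(a,\gamma,\nu)$ of $\mu$ one has $\nu^+(\mathbb R)=\nu^-(\mathbb R)=|\nu|(\mathbb R)=\infty$. 4. $\mu$ is not continuous, that is, $\mu(\{x\})\neq0$ for some $x\in\mathbb R$. Consequently the following assertion is false: for every QID distribution $\mu'$ with characteristic triplet $(a,\gamma,\nu)$, $\mu'$ is continuous (has no atoms) if and only if $a\neq0$ or $|\nu|(\mathbb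 R)=\infty$. This answers Open Question 7.2 of Lindner et al. in the negative. -/

import Mathlib

open MeasureTheory ProbabilityTheory Filter Topology
open scoped ENNReal

namespace QuasiID

/-- The class `𝓑_r` of Borel subsets `B` of `ℝ` with `B ∩ (-r, r) = ∅`. -/
def BorelAway (r : ℝ) : Set (Set ℝ) :=
  {B | MeasurableSet B ∧ B ∩ Set.Ioo (-r) r = ∅}

/-- The class `𝓑₀ = ⋃_{r > 0} 𝓑_r` of Borel sets that are bounded away from zero. -/
def BorelAwayZero : Set (Set ℝ) :=
  {B | ∃ r : ℝ, 0 < r ∧ B ∈ BorelAway r}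

/-- A function `ν : 𝓑₀ → ℝ` whose restriction to each `𝓑_r`, `r > 0`, is a finite signed measure.
As for Mathlib's vector measures, `ν` is extended by the value `0` to all other sets. -/
structure SignedMeasureAwayZero where
  toFun : Set ℝ → ℝ
  empty' : toFun ∅ = 0
  not_mem' : ∀ B : Set ℝ, B ∉ BorelAwayZero → toFun B = 0
  hasSum_iUnion' : ∀ r : ℝ, 0 < r → ∀ B : ℕ → Set ℝ, (∀ n, B n ∈ BorelAway r) →
    Pairwise (Function.onFun Disjoint B) → HasSum (fun n => toFun (B n)) (toFun (⋃ n, B n))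

namespace SignedMeasureAwayZero

open Classical in
/-- The restriction `ν|_{𝓑_r}`, seen as a signed measure on `ℝ` that does not charge `(-r, r)`. -/
noncomputable def restr (ν : SignedMeasureAwayZero) (r : ℝ) (hr : 0 < r) : SignedMeasure ℝ where
  measureOf' B := if MeasurableSet B then ν.toFun (B \ Set.Ioo (-r) r) else 0
  empty' := by simp [ν.empty']
  not_measurable' B hB := by simp [hB]
  m_iUnion' B hB hd := by
    simp only [hB, MeasurableSet.iUnion hB, if_true, Set.iUnion_sdiff]
    refine ν.hasSum_iUnion' r hr _ (fun n => ⟨(hB n).diff measurableSet_Ioo, ?_⟩) ?_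
    · exact Set.sdiff_inter_self
    · intro i j hij
      exact (hd hij).mono Set.sdiff_subset Set.sdiff_subset

open Classical in
theorem restr_apply (ν : SignedMeasureAwayZero) {r : ℝ} (hr : 0 < r) {B : Set ℝ}
    (hB : MeasurableSet B) : ν.restr r hr B = ν.toFun (B \ Set.Ioo (-r) r) := by
  change (if MeasurableSet B then ν.toFun (B \ Set.Ioo (-r) r) else 0) = _
  simp [hB]

/-- On `𝓑_r` the signed measure `ν.restr r` is `ν`. -/
theorem restr_apply_of_mem (ν : SignedMeasureAwayZero) {r : ℝ} (hr : 0 < r) {B : Set ℝ}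
    (hB : B ∈ BorelAway r) : ν.restr r hr B = ν.toFun B := by
  rw [ν.restr_apply hr hB.1, (Set.disjoint_iff_inter_eq_empty.2 hB.2).sdiff_eq_left]

/-- The Jordan decompositions of the restrictions of `ν` are consistent. -/
theorem jordan_restr (ν : SignedMeasureAwayZero) {r s : ℝ} (hr : 0 < r) (hs : 0 < s)
    (hrs : r ≤ s) {B : Set ℝ} (hB : B ∈ BorelAway s) :
    (ν.restr r hr).toJordanDecomposition.posPart B =
        (ν.restr s hs).toJordanDecomposition.posPart B ∧
      (ν.restr r hr).toJordanDecomposition.negPart B =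
        (ν.restr s hs).toJordanDecomposition.negPart B := by
  set j := (ν.restr r hr).toJordanDecomposition with hj
  have hC : MeasurableSet (Set.Ioo (-s) s)ᶜ := measurableSet_Ioo.compl
  let k : JordanDecomposition ℝ :=
    { posPart := j.posPart.restrict (Set.Ioo (-s) s)ᶜ
      negPart := j.negPart.restrict (Set.Ioo (-s) s)ᶜ
      posPart_finite := inferInstance
      negPart_finite := inferInstance
      mutuallySingular := (j.mutuallySingular.mono_ac Measure.restrict_le_self.absolutelyContinuous
        Measure.restrict_le_self.absolutelyContinuous) }
  have hk : (ν.restr s hs).toJordanDecomposition = k := by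
    apply SignedMeasure.toJordanDecomposition_eq
    ext A hA
    have h1 : ν.restr s hs A = ν.restr r hr (A ∩ (Set.Ioo (-s) s)ᶜ) := by
      rw [ν.restr_apply hs hA, ν.restr_apply hr (hA.inter hC), ← Set.sdiff_eq, Set.sdiff_sdiff,
        Set.union_eq_self_of_subset_right (Set.Ioo_subset_Ioo (by linarith) hrs)]
    rw [h1, ← (ν.restr r hr).toSignedMeasure_toJordanDecomposition, ← hj]
    simp only [JordanDecomposition.toSignedMeasure, sub_apply,
      Measure.toSignedMeasure_apply_measurable hA,
      Measure.toSignedMeasure_apply_measurable (hA.inter hC), k, Measure.real,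
      Measure.restrict_apply hA]
  have hBC : B ∩ (Set.Ioo (-s) s)ᶜ = B :=
    Set.inter_eq_left.2 (Set.disjoint_iff_inter_eq_empty.2 hB.2).subset_compl_right
  rw [hk]
  simp [k, Measure.restrict_apply hB.1, hBC]

/-- The measure glued from finite measures `m r` on `{|x| ≥ r}`, `r > 0`, along the partition of
`ℝ \ {0}` into `{|x| ≥ 1}`, `{1/2 ≤ |x| < 1}`, `{1/3 ≤ |x| < 1/2}`, … -/
noncomputable def glue (m : (r : ℝ) → 0 < r → Measure ℝ) : Measure ℝ :=
  Measure.sum fun n : ℕ => (m (1 / ((n : ℝ) + 1)) (by positivity)).restrict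
    (disjointed (fun k : ℕ => (Set.Ioo (-(1 / ((k : ℝ) + 1))) (1 / ((k : ℝ) + 1)))ᶜ) n)

theorem glue_zero (m : (r : ℝ) → 0 < r → Measure ℝ) : glue m {0} = 0 := by
  rw [glue, Measure.sum_apply _ (measurableSet_singleton 0)]
  refine ENNReal.tsum_eq_zero.2 fun n => ?_
  rw [Measure.restrict_apply (measurableSet_singleton 0)]
  have : ({0} : Set ℝ) ∩
      disjointed (fun k : ℕ => (Set.Ioo (-(1 / ((k : ℝ) + 1))) (1 / ((k : ℝ) + 1)))ᶜ) n = ∅ := by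
    rw [Set.singleton_inter_eq_empty]
    intro h
    have h' := disjointed_subset _ n h
    have hp : (0 : ℝ) < 1 / ((n : ℝ) + 1) := by positivity
    exact h' ⟨by linarith, hp⟩
  rw [this, measure_empty]

theorem glue_apply (m : (r : ℝ) → 0 < r → Measure ℝ)
    (hm : ∀ (r s : ℝ) (hr : 0 < r) (hs : 0 < s), r ≤ s → ∀ B ∈ BorelAway s,
      m r hr B = m s hs B) {r : ℝ} (hr : 0 < r) {B : Set ℝ} (hB : B ∈ BorelAway r) :
    glue m B = m r hr B := by
  set D : ℕ → Set ℝ := fun k : ℕ => (Set.Ioo (-(1 / ((k : ℝ) + 1))) (1 / ((k : ℝ) + 1)))ᶜ with hD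
  have hDm : ∀ n, MeasurableSet (disjointed D n) := fun n =>
    MeasurableSet.disjointed (fun k => measurableSet_Ioo.compl) n
  have hsum : m r hr B = ∑' n, m r hr (B ∩ disjointed D n) := by
    rw [← measure_iUnion _ (fun n => hB.1.inter (hDm n)), ← Set.inter_iUnion, iUnion_disjointed]
    · congr 1
      refine (Set.inter_eq_left.2 fun x hx => ?_).symm
      have hx0 : 0 < |x| := by
        refine abs_pos.2 fun h => ?_
        have : x ∈ B ∩ Set.Ioo (-r) r := ⟨hx, by rw [h]; exact ⟨by linarith, hr⟩⟩
        rw [hB.2] at this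
        exact this
      obtain ⟨n, hn⟩ := exists_nat_one_div_lt hx0
      refine Set.mem_iUnion.2 ⟨n, fun h => ?_⟩
      exact absurd (abs_lt.2 ⟨h.1, h.2⟩) (not_lt.2 hn.le)
    · intro i j hij
      exact (disjoint_disjointed D hij).mono Set.inter_subset_right Set.inter_subset_right
  rw [hsum, glue, Measure.sum_apply _ hB.1]
  refine tsum_congr fun n => ?_
  rw [Measure.restrict_apply hB.1]
  have hn : (0 : ℝ) < 1 / ((n : ℝ) + 1) := by positivity
  have h1 : B ∩ disjointed D n ∈ BorelAway r := by
    refine ⟨hB.1.inter (hDm n), Set.subset_empty_iff.1 fun x hx => ?_⟩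
    rw [← hB.2]
    exact ⟨hx.1.1, hx.2⟩
  have h2 : B ∩ disjointed D n ∈ BorelAway (1 / ((n : ℝ) + 1)) :=
    ⟨h1.1, Set.subset_empty_iff.1 fun x hx => disjointed_subset D n hx.1.2 hx.2⟩
  rcases le_total r (1 / ((n : ℝ) + 1)) with h | h
  · exact (hm _ _ hr hn h _ h2).symm
  · exact hm _ _ hn hr h _ h1

/-- The positive part `ν⁺`: the measure on `ℝ` without mass at `0` that agrees on each `𝓑_r` with
the positive part of the Jordan decomposition of `ν|_{𝓑_r}`. -/
noncomputable def posPart (ν : SignedMeasureAwayZero) : Measure ℝ :=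
  glue fun r hr => (ν.restr r hr).toJordanDecomposition.posPart

/-- The negative part `ν⁻`. -/
noncomputable def negPart (ν : SignedMeasureAwayZero) : Measure ℝ :=
  glue fun r hr => (ν.restr r hr).toJordanDecomposition.negPart

/-- The total variation `|ν|`. -/
noncomputable def totalVariation (ν : SignedMeasureAwayZero) : Measure ℝ :=
  glue fun r hr => (ν.restr r hr).totalVariation

theorem posPart_zero (ν : SignedMeasureAwayZero) : ν.posPart {0} = 0 := glue_zero _

theorem negPart_zero (ν : SignedMeasureAwayZero) : ν.negPart {0} = 0 := glue_zero _

theorem totalVariation_zero (ν : SignedMeasureAwayZero) : ν.totalVariation {0} = 0 := glue_zero _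

theorem posPart_apply (ν : SignedMeasureAwayZero) {r : ℝ} (hr : 0 < r) {B : Set ℝ}
    (hB : B ∈ BorelAway r) : ν.posPart B = (ν.restr r hr).toJordanDecomposition.posPart B :=
  glue_apply _ (fun _ _ hr hs hrs _ hB => (ν.jordan_restr hr hs hrs hB).1) hr hB

theorem negPart_apply (ν : SignedMeasureAwayZero) {r : ℝ} (hr : 0 < r) {B : Set ℝ}
    (hB : B ∈ BorelAway r) : ν.negPart B = (ν.restr r hr).toJordanDecomposition.negPart B :=
  glue_apply _ (fun _ _ hr hs hrs _ hB => (ν.jordan_restr hr hs hrs hB).2) hr hB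

theorem totalVariation_apply (ν : SignedMeasureAwayZero) {r : ℝ} (hr : 0 < r) {B : Set ℝ}
    (hB : B ∈ BorelAway r) : ν.totalVariation B = (ν.restr r hr).totalVariation B := by
  refine glue_apply _ (fun r s hr hs hrs B hB => ?_) hr hB
  simp only [SignedMeasure.totalVariation, Measure.add_apply]
  rw [(ν.jordan_restr hr hs hrs hB).1, (ν.jordan_restr hr hs hrs hB).2]

/-- `ν` is a quasi-Lévy type measure: `∫ (1 ∧ x²) |ν|(dx) < ∞`. -/
def IsQuasiLevyType (ν : SignedMeasureAwayZero) : Prop :=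
  ∫⁻ x : ℝ, ENNReal.ofReal (min 1 (x ^ 2)) ∂ν.totalVariation < ∞

/-- The integral `∫ f dν = ∫ f dν⁺ - ∫ f dν⁻`, for `f` integrable with respect to `|ν|`; this
includes all measurable `f` with `|f(x)| ≤ C (1 ∧ x²)` if `ν` is a quasi-Lévy type measure. -/
noncomputable def integral (ν : SignedMeasureAwayZero) (f : ℝ → ℂ) : ℂ :=
  (∫ x, f x ∂ν.posPart) - ∫ x, f x ∂ν.negPart

end SignedMeasureAwayZero

/-- The Lévy–Khintchine integrand `e^{ixz} - 1 - ixz 𝟏_{[-1,1]}(x)`. -/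
noncomputable def lkIntegrand (z x : ℝ) : ℂ :=
  Complex.exp (Complex.I * x * z) - 1 -
    (Set.Icc (-1 : ℝ) 1).indicator (fun x : ℝ => Complex.I * x * z) x

/-- `(a, γ, ν)` is a characteristic triplet of `μ`: `ν` is a quasi-Lévy type measure and `μ` has the
Lévy–Khintchine representation with `a`, `γ` and `ν`. -/
def IsCharacteristicTriplet (μ : Measure ℝ) (a γ : ℝ) (ν : SignedMeasureAwayZero) : Prop :=
  ν.IsQuasiLevyType ∧ ∀ z : ℝ, charFun μ z =
    Complex.exp (-(1 / 2) * a * z ^ 2 + Complex.I * γ * z + ν.integral (lkIntegrand z))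

/-- A probability measure `μ` on `ℝ` is quasi-infinitely divisible. -/
def IsQuasiInfinitelyDivisible (μ : Measure ℝ) : Prop :=
  IsProbabilityMeasure μ ∧
    ∃ (a γ : ℝ) (ν : SignedMeasureAwayZero), IsCharacteristicTriplet μ a γ ν

/-- The nowhere vanishing function `F : ℝ → ℂ` has index `m`: the continuous argument `g` of `F`
(which is unique up to an additive constant) has limits at `±∞`, and
`m = (g(∞) - g(-∞)) / (2π)`. -/
def HasIndex (F : ℝ → ℂ) (m : ℤ) : Prop :=
  (∀ x, F x ≠ 0) ∧ ∃ (g : ℝ → ℝ) (l₁ l₂ : ℝ), Continuous g ∧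
    (∀ x, F x / (‖F x‖ : ℂ) = Complex.exp (Complex.I * g x)) ∧
    Tendsto g atBot (𝓝 l₁) ∧ Tendsto g atTop (𝓝 l₂) ∧ (m : ℝ) = 1 / (2 * Real.pi) * (l₂ - l₁)

/-- The measure `(1/1000) δ₀ + (999/1000) N(1,1)`, where `N(1,1)` is the normal distribution with
mean `1` and variance `1`. -/
noncomputable def exampleMeasure : Measure ℝ :=
  (1 / 1000 : ℝ≥0∞) • Measure.dirac 0 + (999 / 1000 : ℝ≥0∞) • gaussianReal 1 1

end QuasiID

/-!
Write `F(z) = 1 + 999 e^{iz} e^{-z²/2}` (`scaledCF`), so that the characteristic function is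
`F / 1000`. Where `F` is real, `sin z = 0`; since `999 e^{-z²/2}` is below `1` for `|z| ≥ 4` and above
`1` at `±π`, the function `F` has no zero (`scaledCF_ne_zero`), and `F / 1000` has a continuous logarithm
`ψ` (`logCF`), the primitive of `F' / F` that vanishes at zero.

*Index.* On `[0, π]` the curve `F` passes through the upper half-plane from the positive to the
negative half-axis, on `[π, 2π]` it returns through the lower half-plane, and from `3π/2` on it stays
in the right half-plane. So `Im ψ` tends to `2π` at `+∞` and, by symmetry, to `-2π` at `-∞`
(`abs_logCF_im_sub_two_pi_lt`, `tendsto_logCF_atTop`).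

*Quasi-infinite divisibility.* The function `ψ'` is smooth with Gaussian decay, hence
`ψ'(t) = i ∫ e^{ixt} q(x) dx` with `q` real and integrable (`integral_exp_mul_fourierDensity`).
Integration over `t ∈ [0, z]` gives `ψ(z) = ∫ (e^{ixz} - 1) q(x) / x dx`, so `q(x) / x dx` is a
quasi-Lévy measure of the example (`isCharacteristicTriplet_exampleMeasure`); it is of quasi-Lévy
type because `min(1, x²) / |x| ≤ 1`.

*Infinite parts.* Let `(a, γ, ν)` be any triplet. Its exponent is continuous, so it is `ψ`. The real
part of `ψ` is bounded. If `ν⁻` is finite, then `a z²/2 + ∫ (1 - cos xz) ν⁺(dx)` is bounded, which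
forces `a = 0`, and averaging over `z` bounds the mass of `ν⁺`; the same holds with the two parts
exchanged (`isFiniteMeasure_of_abs_re_exponent_le`). If both parts were finite, then `Im ψ(z)` would
be `b z + ∫ sin(xz) ν(dx)`; being bounded it has `b = 0`, and then its means over `[0, n]` tend to `0`
(`eq_zero_of_tendsto_im_exponent`), although `Im ψ → 2π`. So both parts are infinite.

The atom at zero then refutes the proposed characterization of continuity.
-/

namespace QuasiID

/-! ### Signed measures away from zero -/

/-- A measure without mass at zero is determined by its values on the Borel sets that are bounded
away from zero. -/
theorem measure_ext_of_borelAway {P Q : Measure ℝ} (hP : P {0} = 0) (hQ : Q {0} = 0)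
    (h : ∀ r : ℝ, 0 < r → ∀ B ∈ BorelAway r, P B = Q B) : P = Q := by
  ext B hB
  -- `B \ {0}` is the increasing union of the sets `C n`, which are bounded away from zero.
  set C : ℕ → Set ℝ := fun n => B \ Set.Ioo (-(1 / ((n : ℝ) + 1))) (1 / ((n : ℝ) + 1)) with hC
  have hmono : Monotone C := by
    intro m n hmn
    have : 1 / ((n : ℝ) + 1) ≤ 1 / ((m : ℝ) + 1) := Nat.one_div_le_one_div hmn
    exact Set.sdiff_subset_sdiff_right (Set.Ioo_subset_Ioo (by linarith) this)
  have hU : (⋃ n, C n) = B \ {0} := by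
    ext x
    simp only [hC, Set.mem_iUnion, Set.mem_sdiff, Set.mem_singleton_iff, Set.mem_Ioo, ← abs_lt]
    constructor
    · rintro ⟨n, hx, hn⟩
      refine ⟨hx, fun h0 => hn ?_⟩
      rw [h0, abs_zero]
      positivity
    · rintro ⟨hx, h0⟩
      obtain ⟨n, hn⟩ := exists_nat_one_div_lt (abs_pos.2 h0)
      exact ⟨n, hx, not_lt.2 hn.le⟩
  have key : ∀ M : Measure ℝ, M {0} = 0 → M B = ⨆ n, M (C n) := by
    intro M hM
    rw [← hmono.measure_iUnion, hU, measure_sdiff_null hM]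
  rw [key P hP, key Q hQ]
  refine iSup_congr fun n => h (1 / ((n : ℝ) + 1)) (by positivity) _ ⟨?_, ?_⟩
  · exact hB.diff measurableSet_Ioo
  · exact Set.sdiff_inter_self

namespace SignedMeasureAwayZero

theorem totalVariation_eq_add (ν : SignedMeasureAwayZero) :
    ν.totalVariation = ν.posPart + ν.negPart := by
  refine measure_ext_of_borelAway ν.totalVariation_zero ?_ fun r hr B hB => ?_
  · simp [ν.posPart_zero, ν.negPart_zero]
  · rw [Measure.add_apply, ν.totalVariation_apply hr hB, ν.posPart_apply hr hB,
      ν.negPart_apply hr hB, SignedMeasure.totalVariation, Measure.add_apply]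

instance (ν : SignedMeasureAwayZero) : SFinite ν.posPart := by
  unfold posPart glue
  infer_instance

instance (ν : SignedMeasureAwayZero) : SFinite ν.negPart := by
  unfold negPart glue
  infer_instance

open Classical in
/-- The signed measure away from zero with Lebesgue density `f`, where `f` is integrable away from
zero. -/
noncomputable def ofDensity (f : ℝ → ℝ)
    (hf : ∀ r : ℝ, 0 < r → IntegrableOn f (Set.Ioo (-r) r)ᶜ) : SignedMeasureAwayZero where
  toFun B := if B ∈ BorelAwayZero then ∫ x in B, f x else 0
  empty' := by simp
  not_mem' B hB := by simp [hB]
  hasSum_iUnion' r hr B hB hd := by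
    have hU : (⋃ n, B n) ∈ BorelAway r := by
      refine ⟨MeasurableSet.iUnion fun n => (hB n).1, ?_⟩
      simp [Set.iUnion_inter, (hB _).2]
    have hn : ∀ n, B n ∈ BorelAwayZero := fun n => ⟨r, hr, hB n⟩
    have hU' : (⋃ n, B n) ∈ BorelAwayZero := ⟨r, hr, hU⟩
    simp only [hn, hU', if_true]
    exact hasSum_integral_iUnion (fun n => (hB n).1) hd
      ((hf r hr).mono_set (Set.disjoint_iff_inter_eq_empty.2 hU.2).subset_compl_right)

theorem toJordanDecomposition_restr_ofDensity {f : ℝ → ℝ} (hm : Measurable f)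
    (hf : ∀ r : ℝ, 0 < r → IntegrableOn f (Set.Ioo (-r) r)ᶜ) {r : ℝ} (hr : 0 < r) :
    ((ofDensity f hf).restr r hr).toJordanDecomposition.posPart =
        volume.withDensity (fun x => ENNReal.ofReal ((Set.Ioo (-r) r)ᶜ.indicator f x)) ∧
      ((ofDensity f hf).restr r hr).toJordanDecomposition.negPart =
        volume.withDensity (fun x => ENNReal.ofReal (-(Set.Ioo (-r) r)ᶜ.indicator f x)) := by
  have hC : MeasurableSet (Set.Ioo (-r) r)ᶜ := measurableSet_Ioo.compl
  have hi : Integrable ((Set.Ioo (-r) r)ᶜ.indicator f) := (integrable_indicator_iff hC).2 (hf r hr)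
  have h := SignedMeasure.toJordanDecomposition_eq_of_eq_add_withDensity
    (s := (ofDensity f hf).restr r hr) (t := 0) (μ := volume)
    (f := (Set.Ioo (-r) r)ᶜ.indicator f) (hm.indicator hC) hi
    VectorMeasure.MutuallySingular.zero_left ?_
  · have h0 : SignedMeasure.toJordanDecomposition (0 : SignedMeasure ℝ) = 0 :=
      SignedMeasure.toJordanDecomposition_zero
    rw [h]
    dsimp only
    rw [h0]
    exact ⟨zero_add _, zero_add _⟩
  · ext B hB
    rw [restr_apply _ hr hB, zero_add, withDensityᵥ_apply hi hB, setIntegral_indicator hC,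
      ← Set.sdiff_eq]
    have : B \ Set.Ioo (-r) r ∈ BorelAwayZero :=
      ⟨r, hr, hB.diff measurableSet_Ioo, Set.sdiff_inter_self⟩
    simp [ofDensity, this]

theorem withDensity_apply_of_borelAway {f : ℝ → ℝ} {r : ℝ} {B : Set ℝ} (hB : B ∈ BorelAway r)
    {g : ℝ → ℝ≥0∞} (hg : ∀ x ∉ Set.Ioo (-r) r, g x = ENNReal.ofReal (f x)) :
    volume.withDensity g B = volume.withDensity (fun x => ENNReal.ofReal (f x)) B := by
  rw [withDensity_apply _ hB.1, withDensity_apply _ hB.1]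
  refine setLIntegral_congr_fun hB.1 fun x hx => hg x ?_
  exact (Set.disjoint_iff_inter_eq_empty.2 hB.2).subset_compl_right hx

theorem posPart_ofDensity {f : ℝ → ℝ} (hm : Measurable f)
    (hf : ∀ r : ℝ, 0 < r → IntegrableOn f (Set.Ioo (-r) r)ᶜ) :
    (ofDensity f hf).posPart = volume.withDensity fun x => ENNReal.ofReal (f x) := by
  refine measure_ext_of_borelAway (posPart_zero _)
    (withDensity_absolutelyContinuous _ _ (measure_singleton 0)) fun r hr B hB => ?_
  rw [posPart_apply _ hr hB, (toJordanDecomposition_restr_ofDensity hm hf hr).1]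
  exact withDensity_apply_of_borelAway hB fun x hx => by
    rw [Set.indicator_of_mem (Set.mem_compl hx)]

theorem negPart_ofDensity {f : ℝ → ℝ} (hm : Measurable f)
    (hf : ∀ r : ℝ, 0 < r → IntegrableOn f (Set.Ioo (-r) r)ᶜ) :
    (ofDensity f hf).negPart = volume.withDensity fun x => ENNReal.ofReal (-f x) := by
  refine measure_ext_of_borelAway (negPart_zero _)
    (withDensity_absolutelyContinuous _ _ (measure_singleton 0)) fun r hr B hB => ?_
  rw [negPart_apply _ hr hB, (toJordanDecomposition_restr_ofDensity hm hf hr).2]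
  exact withDensity_apply_of_borelAway (f := fun x => -f x) hB fun x hx => by
    rw [Set.indicator_of_mem (Set.mem_compl hx)]

/-- The integral against `f(x) dx` needs integrability of `g * f` only: `f` itself need not be
integrable near zero. -/
theorem integral_ofDensity {f : ℝ → ℝ} (hm : Measurable f)
    (hf : ∀ r : ℝ, 0 < r → IntegrableOn f (Set.Ioo (-r) r)ᶜ) {g : ℝ → ℂ} (hg : Measurable g)
    (hgf : Integrable fun x => g x * f x) :
    (ofDensity f hf).integral g = ∫ x, g x * f x := by
  have hmax : ∀ (F : ℝ → ℝ), Measurable F → (∀ x, |F x| = |f x|) →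
      Integrable fun x => (max (F x) 0 : ℝ) • g x := by
    intro F hF hFf
    refine hgf.mono ?_ (ae_of_all _ fun x => ?_)
    · exact ((hF.max measurable_const).smul hg).aestronglyMeasurable
    · rw [norm_smul, norm_mul, mul_comm, Complex.norm_real, Real.norm_eq_abs, Real.norm_eq_abs,
        ← hFf x, abs_of_nonneg (le_max_right (F x) 0)]
      exact mul_le_mul_of_nonneg_left (max_le (le_abs_self _) (abs_nonneg _)) (norm_nonneg _)
  have hd : ∀ F : ℝ → ℝ, Measurable F →
      ∫ x, g x ∂(volume.withDensity fun x => ENNReal.ofReal (F x)) =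
        ∫ x, (max (F x) 0 : ℝ) • g x := by
    intro F hF
    rw [integral_withDensity_eq_integral_toReal_smul (by fun_prop)
      (ae_of_all _ fun x => ENNReal.ofReal_lt_top)]
    simp only [ENNReal.toReal_ofReal']
  rw [SignedMeasureAwayZero.integral, posPart_ofDensity hm hf, negPart_ofDensity hm hf,
    hd f hm, hd (fun x => -f x) hm.neg,
    ← integral_sub (hmax f hm fun x => rfl) (hmax (fun x => -f x) hm.neg fun x => abs_neg _)]
  refine integral_congr_ae (ae_of_all _ fun x => ?_)
  have h := max_zero_sub_max_neg_zero_eq_self (f x)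
  change max (f x) 0 • g x - max (-f x) 0 • g x = g x * f x
  rw [← sub_smul, h, Complex.real_smul, mul_comm]

theorem totalVariation_ofDensity {f : ℝ → ℝ} (hm : Measurable f)
    (hf : ∀ r : ℝ, 0 < r → IntegrableOn f (Set.Ioo (-r) r)ᶜ) :
    (ofDensity f hf).totalVariation = volume.withDensity fun x => ENNReal.ofReal |f x| := by
  rw [totalVariation_eq_add, posPart_ofDensity hm hf, negPart_ofDensity hm hf,
    ← withDensity_add_left (by fun_prop)]
  congr 1
  ext x
  rw [Pi.add_apply]
  rcases le_total 0 (f x) with h | h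
  · rw [ENNReal.ofReal_of_nonpos (neg_nonpos.2 h), add_zero, abs_of_nonneg h]
  · rw [ENNReal.ofReal_of_nonpos h, zero_add, abs_of_nonpos h]

end SignedMeasureAwayZero

/-! ### The Lévy–Khintchine integrand -/

theorem norm_exp_I_mul_sub_one_sub_le (y : ℝ) :
    ‖Complex.exp (Complex.I * y) - 1 - Complex.I * y‖ ≤ 3 * y ^ 2 := by
  have hn : ‖Complex.I * (y : ℂ)‖ = |y| := by simp
  rcases le_total |y| 1 with h | h
  · have := Complex.norm_exp_sub_one_sub_id_le (x := Complex.I * y) (by rwa [hn])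
    rw [hn, sq_abs] at this
    nlinarith [sq_nonneg y]
  · have h1 : ‖Complex.exp (Complex.I * y) - 1‖ ≤ |y| := Real.norm_exp_I_mul_ofReal_sub_one_le
    have h2 := norm_sub_le (Complex.exp (Complex.I * y) - 1) (Complex.I * y)
    rw [hn] at h2
    nlinarith [sq_abs y]

theorem measurable_lkIntegrand (z : ℝ) : Measurable (lkIntegrand z) := by
  unfold lkIntegrand
  refine Measurable.sub (by fun_prop) (Measurable.indicator (by fun_prop) measurableSet_Icc)

theorem norm_lkIntegrand_le (z x : ℝ) : ‖lkIntegrand z x‖ ≤ (3 * z ^ 2 + 2) * min 1 (x ^ 2) := by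
  unfold lkIntegrand
  by_cases hx : x ∈ Set.Icc (-1 : ℝ) 1
  · have h1 : x ^ 2 ≤ 1 := by nlinarith [hx.1, hx.2]
    rw [Set.indicator_of_mem hx, min_eq_right h1]
    have := norm_exp_I_mul_sub_one_sub_le (x * z)
    push_cast at this
    rw [← mul_assoc] at this
    nlinarith [sq_nonneg x]
  · have h1 : 1 ≤ x ^ 2 := by
      by_contra! h
      exact hx (abs_le.1 ((sq_lt_one_iff_abs_lt_one x).1 h).le)
    rw [Set.indicator_of_notMem hx, sub_zero, min_eq_left h1]
    have h2 := norm_sub_le (Complex.exp (Complex.I * x * z)) 1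
    have h3 : ‖Complex.exp (Complex.I * x * z)‖ = 1 := by
      rw [show Complex.I * x * z = ((x * z : ℝ) : ℂ) * Complex.I by push_cast; ring,
        Complex.norm_exp_ofReal_mul_I]
    rw [h3, norm_one] at h2
    nlinarith [sq_nonneg z]

theorem integrable_min_one_sq {P : Measure ℝ}
    (hP : ∫⁻ x : ℝ, ENNReal.ofReal (min 1 (x ^ 2)) ∂P < ∞) :
    Integrable (fun x : ℝ => min 1 (x ^ 2)) P := by
  refine ⟨by fun_prop, ?_⟩
  rwa [hasFiniteIntegral_iff_ofReal (ae_of_all _ fun x => by positivity)]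

theorem integrable_lkIntegrand {P : Measure ℝ}
    (hP : ∫⁻ x : ℝ, ENNReal.ofReal (min 1 (x ^ 2)) ∂P < ∞) (z : ℝ) :
    Integrable (lkIntegrand z) P :=
  ((integrable_min_one_sq hP).const_mul (3 * z ^ 2 + 2)).mono'
    (measurable_lkIntegrand z).aestronglyMeasurable (ae_of_all _ fun x => norm_lkIntegrand_le z x)

theorem continuous_integral_lkIntegrand {P : Measure ℝ}
    (hP : ∫⁻ x : ℝ, ENNReal.ofReal (min 1 (x ^ 2)) ∂P < ∞) :
    Continuous fun z => ∫ x, lkIntegrand z x ∂P := by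
  refine continuous_iff_continuousAt.2 fun z₀ => ?_
  refine continuousAt_of_dominated
    (bound := fun x => (3 * (|z₀| + 1) ^ 2 + 2) * min 1 (x ^ 2))
    (Eventually.of_forall fun z => (measurable_lkIntegrand z).aestronglyMeasurable) ?_
    ((integrable_min_one_sq hP).const_mul _) (ae_of_all _ fun x => ?_)
  · filter_upwards [Metric.ball_mem_nhds z₀ one_pos] with z hz
    refine ae_of_all _ fun x => (norm_lkIntegrand_le z x).trans ?_
    have : |z| ≤ |z₀| + 1 := by
      rw [Metric.mem_ball, Real.dist_eq] at hz
      linarith [abs_sub_abs_le_abs_sub z z₀]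
    rw [← sq_abs z]
    gcongr
  · unfold lkIntegrand
    by_cases hx : x ∈ Set.Icc (-1 : ℝ) 1
    · simp only [Set.indicator_of_mem hx]
      fun_prop
    · simp only [Set.indicator_of_notMem hx]
      fun_prop

theorem lkIntegrand_re (z x : ℝ) : (lkIntegrand z x).re = -(1 - Real.cos (x * z)) := by
  have h : (Complex.exp (Complex.I * x * z)).re = Real.cos (x * z) := by
    rw [← Complex.exp_ofReal_mul_I_re]
    congr 2; push_cast; ring
  unfold lkIntegrand
  rw [Complex.sub_re, Complex.sub_re, h]
  by_cases hx : x ∈ Set.Icc (-1 : ℝ) 1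
  · simp [Set.indicator_of_mem hx]
  · simp [Set.indicator_of_notMem hx]

theorem lkIntegrand_im (z x : ℝ) :
    (lkIntegrand z x).im = Real.sin (x * z) - z * (Set.Icc (-1 : ℝ) 1).indicator id x := by
  have h : (Complex.exp (Complex.I * x * z)).im = Real.sin (x * z) := by
    rw [← Complex.exp_ofReal_mul_I_im]
    congr 2; push_cast; ring
  unfold lkIntegrand
  rw [Complex.sub_im, Complex.sub_im, h]
  by_cases hx : x ∈ Set.Icc (-1 : ℝ) 1
  · simp [Set.indicator_of_mem hx, mul_comm]
  · simp [Set.indicator_of_notMem hx]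

/-! ### Bounded exponents and finite parts -/

theorem abs_one_sub_cos_le (z x : ℝ) :
    |1 - Real.cos (x * z)| ≤ (3 * z ^ 2 + 2) * min 1 (x ^ 2) := by
  have h := (Complex.abs_re_le_norm _).trans (norm_lkIntegrand_le z x)
  rwa [lkIntegrand_re, abs_neg] at h

theorem integrable_one_sub_cos {P : Measure ℝ}
    (hP : ∫⁻ x : ℝ, ENNReal.ofReal (min 1 (x ^ 2)) ∂P < ∞) (z : ℝ) :
    Integrable (fun x => 1 - Real.cos (x * z)) P :=
  ((integrable_min_one_sq hP).const_mul (3 * z ^ 2 + 2)).mono'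
    (by fun_prop) (ae_of_all _ fun x => abs_one_sub_cos_le z x)

theorem tendsto_integral_one_sub_cos_div_sq {P : Measure ℝ}
    (hP : ∫⁻ x : ℝ, ENNReal.ofReal (min 1 (x ^ 2)) ∂P < ∞) :
    Tendsto (fun z : ℝ => (∫ x, (1 - Real.cos (x * z)) ∂P) / z ^ 2) atTop (𝓝 0) := by
  have h := tendsto_integral_filter_of_dominated_convergence (μ := P) (l := atTop)
    (F := fun (z x : ℝ) => (1 - Real.cos (x * z)) / z ^ 2) (f := fun _ => 0)
    (fun x => 5 * min 1 (x ^ 2)) (Eventually.of_forall fun z => by fun_prop) ?_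
    ((integrable_min_one_sq hP).const_mul 5) (ae_of_all _ fun x => ?_)
  · simpa [integral_div] using h
  · filter_upwards [eventually_ge_atTop 1] with z hz
    refine ae_of_all _ fun x => ?_
    have hz2 : (1 : ℝ) ≤ z ^ 2 := by nlinarith
    rw [Real.norm_eq_abs, abs_div, abs_of_nonneg (sq_nonneg z), div_le_iff₀ (by linarith)]
    refine (abs_one_sub_cos_le z x).trans ?_
    have : 0 ≤ min 1 (x ^ 2) := by positivity
    nlinarith
  · have h2 : Tendsto (fun z : ℝ => 2 / z ^ 2) atTop (𝓝 0) :=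
      (tendsto_pow_atTop two_ne_zero).const_div_atTop 2
    refine squeeze_zero (fun z => ?_) (fun z => ?_) h2
    · exact div_nonneg (by linarith [Real.cos_le_one (x * z)]) (sq_nonneg z)
    · gcongr
      linarith [Real.neg_one_le_cos (x * z)]

/-- The window `[0, 2 / r]` is so long that `1 - cos (x z)` has mean at least `1 / 2` over it for all
`|x| ≥ r`. -/
theorem one_div_le_integral_one_sub_cos {r x : ℝ} (hr : 0 < r) (hx : r ≤ |x|) :
    1 / r ≤ ∫ z in (0 : ℝ)..(2 / r), (1 - Real.cos (x * z)) := by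
  have hx0 : x ≠ 0 := abs_pos.1 (hr.trans_le hx)
  have h : ∫ z in (0 : ℝ)..(2 / r), Real.cos (x * z) = x⁻¹ * Real.sin (x * (2 / r)) := by
    rw [intervalIntegral.integral_comp_mul_left (fun z => Real.cos z) hx0]
    simp
  rw [intervalIntegral.integral_sub (by simp) (by
    apply Continuous.intervalIntegrable; fun_prop), h]
  have h1 : x⁻¹ * Real.sin (x * (2 / r)) ≤ 1 / r := by
    refine (le_abs_self _).trans ?_
    rw [abs_mul, abs_inv, one_div]
    calc |x|⁻¹ * |Real.sin (x * (2 / r))| ≤ |x|⁻¹ * 1 := by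
          gcongr
          exact Real.abs_sin_le_one _
      _ ≤ r⁻¹ := by
          rw [mul_one]
          gcongr
  have h2 : ∫ _z in (0 : ℝ)..(2 / r), (1 : ℝ) = 2 / r := by simp
  have h3 : 2 / r = 1 / r + 1 / r := by ring
  linarith

/-- A truncation inequality, by Tonelli's theorem on `[0, 2 / r] × ℝ`. -/
theorem measure_le_of_integral_one_sub_cos_le {P : Measure ℝ} [SFinite P]
    (hP : ∫⁻ x : ℝ, ENNReal.ofReal (min 1 (x ^ 2)) ∂P < ∞) {C : ℝ}
    (h : ∀ z, ∫ x, (1 - Real.cos (x * z)) ∂P ≤ C) {r : ℝ} (hr : 0 < r) :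
    P {x | r ≤ |x|} ≤ 2 * ENNReal.ofReal C := by
  have hnn : ∀ x z : ℝ, 0 ≤ 1 - Real.cos (x * z) := fun x z => by
    linarith [Real.cos_le_one (x * z)]
  have hT : (0 : ℝ) ≤ 2 / r := by positivity
  have hS : MeasurableSet {x : ℝ | r ≤ |x|} := measurableSet_le measurable_const (by fun_prop)
  have h1 : ENNReal.ofReal (1 / r) * P {x | r ≤ |x|} ≤
      ∫⁻ x, (∫⁻ z in Set.Ioc 0 (2 / r), ENNReal.ofReal (1 - Real.cos (x * z))) ∂P := by
    rw [← setLIntegral_const]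
    refine (setLIntegral_mono' hS fun x hx => ?_).trans (setLIntegral_le_lintegral _ _)
    rw [← ofReal_integral_eq_lintegral_ofReal _ (ae_of_all _ (hnn x)),
      ← intervalIntegral.integral_of_le hT]
    · exact ENNReal.ofReal_le_ofReal (one_div_le_integral_one_sub_cos hr hx)
    · exact (Continuous.integrableOn_Icc (by fun_prop)).mono_set Set.Ioc_subset_Icc_self
  have h2 : ∫⁻ x, (∫⁻ z in Set.Ioc 0 (2 / r), ENNReal.ofReal (1 - Real.cos (x * z))) ∂P ≤
      ENNReal.ofReal C * ENNReal.ofReal (2 / r) := by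
    rw [lintegral_lintegral_swap (by fun_prop)]
    calc _ ≤ ∫⁻ _z in Set.Ioc 0 (2 / r), ENNReal.ofReal C := by
          refine lintegral_mono fun z => ?_
          rw [← ofReal_integral_eq_lintegral_ofReal (integrable_one_sub_cos hP z)
            (ae_of_all _ fun x => hnn x z)]
          exact ENNReal.ofReal_le_ofReal (h z)
      _ = _ := by rw [setLIntegral_const, Real.volume_Ioc, sub_zero]
  have h3 : ENNReal.ofReal (2 / r) = ENNReal.ofReal (1 / r) * 2 := by
    rw [← ENNReal.ofReal_ofNat 2, ← ENNReal.ofReal_mul (by positivity)]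
    congr 1
    ring
  have h4 := h1.trans h2
  rw [h3, mul_comm, mul_comm (ENNReal.ofReal C), mul_assoc, mul_comm (ENNReal.ofReal (1 / r))] at h4
  refine (ENNReal.mul_le_mul_iff_left ?_ ENNReal.ofReal_ne_top).1 h4
  exact (ENNReal.ofReal_pos.2 (by positivity)).ne'

theorem isFiniteMeasure_of_integral_one_sub_cos_le {P : Measure ℝ} [SFinite P]
    (hP : ∫⁻ x : ℝ, ENNReal.ofReal (min 1 (x ^ 2)) ∂P < ∞) (hP0 : P {0} = 0) {C : ℝ}
    (h : ∀ z, ∫ x, (1 - Real.cos (x * z)) ∂P ≤ C) : IsFiniteMeasure P := by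
  have hmono : Monotone fun n : ℕ => {x : ℝ | 1 / ((n : ℝ) + 1) ≤ |x|} :=
    fun m n hmn x hx => le_trans (b := 1 / ((m : ℝ) + 1)) (Nat.one_div_le_one_div hmn) hx
  have hU : (⋃ n : ℕ, {x : ℝ | 1 / ((n : ℝ) + 1) ≤ |x|}) = Set.univ \ {0} := by
    ext x
    simp only [Set.mem_iUnion, Set.mem_ofPred_eq, Set.mem_sdiff, Set.mem_univ, true_and,
      Set.mem_singleton_iff]
    refine ⟨?_, fun h0 => ?_⟩
    · rintro ⟨n, hn⟩ rfl
      have : 0 < 1 / ((n : ℝ) + 1) := by positivity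
      rw [abs_zero] at hn
      linarith
    · obtain ⟨n, hn⟩ := exists_nat_one_div_lt (abs_pos.2 h0)
      exact ⟨n, hn.le⟩
  refine ⟨lt_of_le_of_lt (b := 2 * ENNReal.ofReal C) ?_
    (ENNReal.mul_lt_top (by simp) ENNReal.ofReal_lt_top)⟩
  rw [← measure_sdiff_null hP0, ← hU, hmono.measure_iUnion]
  exact iSup_le fun n => measure_le_of_integral_one_sub_cos_le hP h (by positivity)

/-- If the real part of a Lévy–Khintchine exponent is bounded and one of the two parts of the
quasi-Lévy measure is finite, so is the other one. -/
theorem isFiniteMeasure_of_abs_re_exponent_le {P N : Measure ℝ} [SFinite P] [IsFiniteMeasure N]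
    (hP : ∫⁻ x : ℝ, ENNReal.ofReal (min 1 (x ^ 2)) ∂P < ∞) (hP0 : P {0} = 0) {a C : ℝ}
    (h : ∀ z, |a * z ^ 2 + (∫ x, (1 - Real.cos (x * z)) ∂P) -
      ∫ x, (1 - Real.cos (x * z)) ∂N| ≤ C) : IsFiniteMeasure P := by
  have hN : ∀ z, |∫ x, (1 - Real.cos (x * z)) ∂N| ≤ 2 * N.real Set.univ := fun z => by
    rw [← Real.norm_eq_abs]
    refine norm_integral_le_of_norm_le_const (ae_of_all _ fun x => ?_)
    rw [Real.norm_eq_abs, abs_le]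
    constructor <;> linarith [Real.cos_le_one (x * z), Real.neg_one_le_cos (x * z)]
  have hK : ∀ z, |a * z ^ 2 + ∫ x, (1 - Real.cos (x * z)) ∂P| ≤ C + 2 * N.real Set.univ := by
    intro z
    have h1 := abs_le.1 (h z)
    have h2 := abs_le.1 (hN z)
    exact abs_le.2 ⟨by linarith [h1.1, h2.1], by linarith [h1.2, h2.2]⟩
  have hlim : Tendsto (fun z : ℝ => (a * z ^ 2 + ∫ x, (1 - Real.cos (x * z)) ∂P) / z ^ 2)
      atTop (𝓝 0) := by
    have h2 : Tendsto (fun z : ℝ => (C + 2 * N.real Set.univ) / z ^ 2) atTop (𝓝 0) :=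
      (tendsto_pow_atTop two_ne_zero).const_div_atTop _
    refine squeeze_zero_norm (fun z => ?_) h2
    rw [Real.norm_eq_abs, abs_div, abs_of_nonneg (sq_nonneg z)]
    gcongr
    exact hK z
  -- Division by `z²` leaves only the Gaussian coefficient in the limit.
  have ha : a = 0 := by
    refine tendsto_nhds_unique ?_ hlim
    have h3 := (tendsto_integral_one_sub_cos_div_sq hP).const_add a
    rw [add_zero] at h3
    refine h3.congr' ?_
    filter_upwards [eventually_gt_atTop 0] with z hz
    rw [add_div, mul_div_cancel_right₀ _ (pow_pos hz 2).ne']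
  refine isFiniteMeasure_of_integral_one_sub_cos_le hP hP0 (C := C + 2 * N.real Set.univ)
    fun z => ?_
  have := (le_abs_self _).trans (hK z)
  rwa [ha, zero_mul, zero_add] at this

theorem abs_integral_sin_le (P : Measure ℝ) [IsFiniteMeasure P] (z : ℝ) :
    |∫ x, Real.sin (x * z) ∂P| ≤ P.real Set.univ := by
  have := norm_integral_le_of_norm_le_const (μ := P) (f := fun x => Real.sin (x * z)) (C := 1)
    (ae_of_all _ fun x => Real.abs_sin_le_one _)
  simpa using this

theorem continuous_integral_sin (P : Measure ℝ) [IsFiniteMeasure P] :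
    Continuous fun z => ∫ x, Real.sin (x * z) ∂P :=
  continuous_of_dominated (bound := fun _ => 1) (fun z => by fun_prop)
    (fun z => ae_of_all _ fun x => Real.abs_sin_le_one _) (by fun_prop)
    (ae_of_all _ fun x => by fun_prop)

theorem abs_integral_sin_mul_le (c : ℝ) :
    |∫ s in (0 : ℝ)..1, Real.sin (c * s)| ≤ 2 / |c| := by
  rcases eq_or_ne c 0 with rfl | hc
  · simp
  · rw [intervalIntegral.integral_comp_mul_left (fun z => Real.sin z) hc, integral_sin]
    simp only [mul_zero, Real.cos_zero, mul_one, smul_eq_mul, abs_mul, abs_inv]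
    rw [div_eq_inv_mul]
    gcongr
    rw [abs_le]
    constructor <;> linarith [Real.cos_le_one c, Real.neg_one_le_cos c]

/-- The means of the sine transform of a finite measure over `[0, n]` tend to zero. -/
theorem tendsto_mean_integral_sin (P : Measure ℝ) [IsFiniteMeasure P] :
    Tendsto (fun n : ℕ => ∫ s in (0 : ℝ)..1, ∫ x, Real.sin (x * (n * s)) ∂P) atTop (𝓝 0) := by
  have hswap : ∀ n : ℕ, ∫ s in (0 : ℝ)..1, ∫ x, Real.sin (x * (n * s)) ∂P =
      ∫ x, (∫ s in (0 : ℝ)..1, Real.sin (x * n * s)) ∂P := by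
    intro n
    simp only [← mul_assoc]
    refine intervalIntegral_integral_swap (f := fun s x : ℝ => Real.sin (x * n * s)) ?_
    have : IsFiniteMeasure (volume.restrict (Set.uIoc (0 : ℝ) 1)) := by
      rw [Set.uIoc_of_le zero_le_one]
      infer_instance
    exact (integrable_const (1 : ℝ)).mono' (by fun_prop)
      (ae_of_all _ fun p => Real.abs_sin_le_one _)
  simp only [hswap]
  have h := tendsto_integral_of_dominated_convergence (μ := P)
    (F := fun (n : ℕ) (x : ℝ) => ∫ s in (0 : ℝ)..1, Real.sin (x * n * s)) (f := fun _ => 0)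
    (fun _ => 1) (fun n => ?_) (integrable_const 1) (fun n => ae_of_all _ fun x => ?_)
    (ae_of_all _ fun x => ?_)
  · simpa using h
  · refine Continuous.aestronglyMeasurable ?_
    exact intervalIntegral.continuous_parametric_intervalIntegral_of_continuous'
      (f := fun x s : ℝ => Real.sin (x * n * s)) (by fun_prop) 0 1
  · have := intervalIntegral.norm_integral_le_of_norm_le_const (a := 0) (b := 1) (C := 1)
      (f := fun s => Real.sin (x * n * s)) fun s _ => Real.abs_sin_le_one _
    simpa using this
  · rcases eq_or_ne x 0 with rfl | hx
    · simp
    · refine squeeze_zero_norm (fun n => abs_integral_sin_mul_le (x * n)) ?_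
      refine Tendsto.const_div_atTop ?_ 2
      simp only [abs_mul, Nat.abs_cast]
      exact tendsto_natCast_atTop_atTop.const_mul_atTop (abs_pos.2 hx)

/-- The imaginary part of a Lévy–Khintchine exponent with a finite quasi-Lévy measure cannot have
a nonzero limit at infinity: its means tend to zero. -/
theorem eq_zero_of_tendsto_im_exponent {P N : Measure ℝ} [IsFiniteMeasure P] [IsFiniteMeasure N]
    {b l : ℝ} (h : Tendsto (fun z => b * z + (∫ x, Real.sin (x * z) ∂P) -
      ∫ x, Real.sin (x * z) ∂N) atTop (𝓝 l)) : l = 0 := by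
  set g : ℝ → ℝ := fun z => (∫ x, Real.sin (x * z) ∂P) - ∫ x, Real.sin (x * z) ∂N with hg
  have hgb : ∀ z, |g z| ≤ P.real Set.univ + N.real Set.univ := fun z =>
    (abs_sub _ _).trans (add_le_add (abs_integral_sin_le P z) (abs_integral_sin_le N z))
  have hgc : Continuous g := (continuous_integral_sin P).sub (continuous_integral_sin N)
  -- Division by `z` leaves only the drift in the limit.
  have hb : b = 0 := by
    have h1 : Tendsto (fun z => g z / z) atTop (𝓝 0) := by
      have h2 : Tendsto (fun z : ℝ => (P.real Set.univ + N.real Set.univ) / |z|) atTop (𝓝 0) :=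
        tendsto_abs_atTop_atTop.const_div_atTop _
      refine squeeze_zero_norm (fun z => ?_) h2
      rw [Real.norm_eq_abs, abs_div]
      gcongr
      exact hgb z
    have h3 := h1.const_add b
    rw [add_zero] at h3
    refine tendsto_nhds_unique h3 ((h.div_atTop tendsto_id).congr' ?_)
    filter_upwards [eventually_gt_atTop 0] with z hz
    simp only [hg, id]
    field_simp
    ring
  have hgl : Tendsto g atTop (𝓝 l) := by
    refine h.congr fun z => ?_
    rw [hb, hg]
    ring
  -- The means of `g` over `[0, n]` tend both to `l` and to `0`.
  have h1 : Tendsto (fun n : ℕ => ∫ s in (0 : ℝ)..1, g (n * s)) atTop (𝓝 l) := by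
    have h2 := intervalIntegral.tendsto_integral_filter_of_dominated_convergence
      (μ := volume) (a := 0) (b := 1) (l := atTop) (F := fun (n : ℕ) (s : ℝ) => g (n * s))
      (f := fun _ => l) (fun _ => P.real Set.univ + N.real Set.univ)
      (Eventually.of_forall fun n => by fun_prop)
      (Eventually.of_forall fun n => ae_of_all _ fun s _ => hgb _) (by simp)
      (ae_of_all _ fun s hs => ?_)
    · simpa using h2
    · rw [Set.uIoc_of_le zero_le_one] at hs
      exact hgl.comp (tendsto_natCast_atTop_atTop.atTop_mul_const hs.1)
  have h2 : Tendsto (fun n : ℕ => ∫ s in (0 : ℝ)..1, g (n * s)) atTop (𝓝 0) := by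
    have h3 := (tendsto_mean_integral_sin P).sub (tendsto_mean_integral_sin N)
    rw [sub_zero] at h3
    refine h3.congr fun n => ?_
    rw [← intervalIntegral.integral_sub]
    · exact ((continuous_integral_sin P).comp (continuous_const.mul
        continuous_id)).intervalIntegrable _ _
    · exact ((continuous_integral_sin N).comp (continuous_const.mul
        continuous_id)).intervalIntegrable _ _
  exact tendsto_nhds_unique h1 h2

/-! ### The characteristic function and its logarithm -/

/-- The characteristic function `e^{iz - z²/2}` of `N(1,1)`. -/
noncomputable def normalCF (z : ℝ) : ℂ := Complex.exp (Complex.I * z - (z : ℂ) ^ 2 / 2)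

/-- The characteristic function of `exampleMeasure` multiplied by `1000`. -/
noncomputable def scaledCF (z : ℝ) : ℂ := 1 + 999 * normalCF z

/-- The logarithmic derivative of the characteristic function of `exampleMeasure`. -/
noncomputable def logDerivCF (z : ℝ) : ℂ := 999 * (Complex.I - z) * normalCF z / scaledCF z

/-- The distinguished logarithm of the characteristic function of `exampleMeasure`, as the
primitive of its logarithmic derivative that vanishes at zero. -/
noncomputable def logCF (z : ℝ) : ℂ := ∫ t in (0 : ℝ)..z, logDerivCF t

theorem charFun_exampleMeasure (z : ℝ) : charFun exampleMeasure z = scaledCF z / 1000 := by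
  have h : ∀ (c : ℝ≥0∞) (m : Measure ℝ), charFun (c • m) z = c.toReal • charFun m z := by
    intro c m
    rw [charFun_apply, charFun_apply, integral_smul_measure]
  have h2 : charFun exampleMeasure z =
      charFun ((1 / 1000 : ℝ≥0∞) • Measure.dirac (0 : ℝ)) z +
        charFun ((999 / 1000 : ℝ≥0∞) • gaussianReal 1 1) z := by
    have hi : ∀ (m : Measure ℝ) [IsProbabilityMeasure m] (c : ℝ≥0∞), c ≠ ∞ →
        Integrable (fun x : ℝ => Complex.exp (z * x * Complex.I)) (c • m) := by
      intro m _ c hc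
      refine Integrable.smul_measure ?_ hc
      refine (integrable_const (1 : ℝ)).mono' (by fun_prop) (ae_of_all _ fun x => ?_)
      rw [← Complex.ofReal_mul, Complex.norm_exp_ofReal_mul_I]
    simp only [charFun_apply_real]
    rw [exampleMeasure, integral_add_measure]
    · exact hi _ _ (ENNReal.div_lt_top (by simp) (by simp)).ne
    · exact hi _ _ (ENNReal.div_lt_top (by simp) (by simp)).ne
  rw [h2, h, h, charFun_dirac, charFun_gaussianReal, scaledCF, normalCF]
  simp only [inner_zero_left, Complex.ofReal_zero, zero_mul, Complex.exp_zero, Complex.real_smul,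
    ENNReal.toReal_div, ENNReal.toReal_one, ENNReal.toReal_ofNat, NNReal.coe_one,
    Complex.ofReal_one]
  rw [show Complex.I * (z : ℂ) - (z : ℂ) ^ 2 / 2 = z * 1 * Complex.I - 1 * z ^ 2 / 2 by ring]
  push_cast
  ring

theorem normalCF_eq (z : ℝ) :
    normalCF z = (Real.exp (-z ^ 2 / 2) : ℝ) * Complex.exp (z * Complex.I) := by
  rw [normalCF, Complex.ofReal_exp, ← Complex.exp_add]
  congr 1
  push_cast
  ring

theorem norm_normalCF (z : ℝ) : ‖normalCF z‖ = Real.exp (-z ^ 2 / 2) := by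
  rw [normalCF_eq, norm_mul, Complex.norm_exp_ofReal_mul_I, mul_one, Complex.norm_real,
    Real.norm_eq_abs, Real.abs_exp]

theorem scaledCF_re (z : ℝ) :
    (scaledCF z).re = 1 + 999 * (Real.exp (-z ^ 2 / 2) * Real.cos z) := by
  rw [scaledCF, normalCF_eq, Complex.add_re, Complex.one_re,
    show (999 : ℂ) = ((999 : ℝ) : ℂ) by norm_num, Complex.re_ofReal_mul,
    Complex.re_ofReal_mul, Complex.exp_ofReal_mul_I_re]

theorem scaledCF_im (z : ℝ) :
    (scaledCF z).im = 999 * (Real.exp (-z ^ 2 / 2) * Real.sin z) := by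
  rw [scaledCF, normalCF_eq, Complex.add_im, Complex.one_im,
    show (999 : ℂ) = ((999 : ℝ) : ℂ) by norm_num, Complex.im_ofReal_mul,
    Complex.im_ofReal_mul, Complex.exp_ofReal_mul_I_im, zero_add]

theorem scaledCF_re_pos_of_four_le {z : ℝ} (hz : 4 ≤ |z|) : 0 < (scaledCF z).re := by
  have h1 : Real.exp (-z ^ 2 / 2) ≤ Real.exp (-8) := by
    refine Real.exp_le_exp.2 ?_
    nlinarith [sq_abs z]
  have h2 : 999 * Real.exp (-8) < 1 := by
    rw [Real.exp_neg, ← div_eq_mul_inv, div_lt_one (Real.exp_pos _)]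
    calc (999 : ℝ) < 2.7 ^ 8 := by norm_num
      _ ≤ Real.exp 1 ^ 8 := by gcongr; linarith [Real.exp_one_gt_d9]
      _ = Real.exp 8 := by rw [← Real.exp_nat_mul]; norm_num
  rw [scaledCF_re]
  nlinarith [Real.neg_one_le_cos z, Real.exp_pos (-z ^ 2 / 2)]

theorem scaledCF_pi_re_neg : (scaledCF Real.pi).re < 0 := by
  rw [scaledCF_re, Real.cos_pi]
  have h1 : Real.exp (-5) ≤ Real.exp (-Real.pi ^ 2 / 2) := by
    refine Real.exp_le_exp.2 ?_
    nlinarith [Real.pi_lt_d2, Real.pi_pos]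
  have h2 : 1 < 999 * Real.exp (-5) := by
    rw [Real.exp_neg, ← div_eq_mul_inv, one_lt_div (Real.exp_pos _)]
    calc Real.exp 5 = Real.exp 1 ^ 5 := by rw [← Real.exp_nat_mul]; norm_num
      _ < 3 ^ 5 := by gcongr; exact Real.exp_one_lt_three
      _ < 999 := by norm_num
  linarith

theorem normalCF_neg (z : ℝ) : normalCF (-z) = (starRingEnd ℂ) (normalCF z) := by
  rw [normalCF, normalCF, ← Complex.exp_conj]
  congr 1
  simp only [map_sub, map_mul, map_div₀, map_pow, Complex.conj_I, Complex.conj_ofReal, map_ofNat,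
    Complex.ofReal_neg]
  ring

theorem scaledCF_neg (z : ℝ) : scaledCF (-z) = (starRingEnd ℂ) (scaledCF z) := by
  simp only [scaledCF, normalCF_neg, map_add, map_mul, map_one, map_ofNat]

theorem scaledCF_ne_zero (z : ℝ) : scaledCF z ≠ 0 := by
  intro h
  have hre : (scaledCF z).re = 0 := by rw [h, Complex.zero_re]
  have him : (scaledCF z).im = 0 := by rw [h, Complex.zero_im]
  have hlt : |z| < 4 := by
    by_contra! h4
    exact (scaledCF_re_pos_of_four_le h4).ne' hre
  rw [scaledCF_im] at him
  have hsin : Real.sin z = 0 := by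
    simpa [(Real.exp_pos _).ne'] using him
  -- The zeros of `sin` in `(-4, 4)` are `0` and `±π`.
  have hsin' : Real.sin |z| = 0 := by
    rcases abs_choice z with h' | h' <;> simp [h', hsin]
  have hre' : (scaledCF |z|).re = 0 := by
    rw [scaledCF_re, sq_abs, Real.cos_abs, ← scaledCF_re, hre]
  rcases (abs_nonneg z).eq_or_lt with h0 | h0
  · rw [← h0, scaledCF_re] at hre'
    norm_num at hre'
  · rcases lt_trichotomy |z| Real.pi with hp | hp | hp
    · exact (Real.sin_pos_of_pos_of_lt_pi h0 hp).ne' hsin'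
    · rw [hp] at hre'
      exact scaledCF_pi_re_neg.ne hre'
    · have h1 := Real.sin_pos_of_pos_of_lt_pi (x := |z| - Real.pi) (by linarith)
        (by linarith [Real.pi_gt_three])
      rw [Real.sin_sub_pi, hsin', neg_zero] at h1
      exact lt_irrefl _ h1

theorem hasDerivAt_normalCF (z : ℝ) : HasDerivAt normalCF ((Complex.I - z) * normalCF z) z := by
  have h1 : HasDerivAt (fun z : ℝ => (z : ℂ)) 1 z := Complex.ofRealCLM.hasDerivAt
  have h2 := ((h1.const_mul Complex.I).sub ((h1.pow 2).div_const 2)).cexp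
  refine h2.congr_deriv ?_
  rw [normalCF, mul_comm]
  simp

theorem hasDerivAt_scaledCF (z : ℝ) :
    HasDerivAt scaledCF (999 * (Complex.I - z) * normalCF z) z := by
  refine (((hasDerivAt_normalCF z).const_mul 999).const_add 1).congr_deriv ?_
  ring

theorem continuous_normalCF : Continuous normalCF := by
  unfold normalCF
  fun_prop

theorem continuous_scaledCF : Continuous scaledCF := by
  unfold scaledCF
  exact continuous_const.add (continuous_const.mul continuous_normalCF)

theorem continuous_logDerivCF : Continuous logDerivCF := by
  unfold logDerivCF
  have := continuous_normalCF
  exact Continuous.div (by fun_prop) continuous_scaledCF scaledCF_ne_zero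

theorem hasDerivAt_logCF (z : ℝ) : HasDerivAt logCF (logDerivCF z) z :=
  intervalIntegral.integral_hasDerivAt_right (continuous_logDerivCF.intervalIntegrable _ _)
    continuous_logDerivCF.aestronglyMeasurable.stronglyMeasurableAtFilter
    continuous_logDerivCF.continuousAt

theorem continuous_logCF : Continuous logCF :=
  continuous_iff_continuousAt.2 fun z => (hasDerivAt_logCF z).continuousAt

theorem logCF_zero : logCF 0 = 0 := intervalIntegral.integral_same

theorem exp_logCF (z : ℝ) : Complex.exp (logCF z) = scaledCF z / 1000 := by
  -- `F e^{-ψ}` is constant.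
  have hd : ∀ z, HasDerivAt (fun z => scaledCF z * Complex.exp (-logCF z)) 0 z := by
    intro z
    refine ((hasDerivAt_scaledCF z).mul (hasDerivAt_logCF z).neg.cexp).congr_deriv ?_
    rw [logDerivCF]
    field_simp [scaledCF_ne_zero z]
    ring
  have hc := is_const_of_deriv_eq_zero (fun z => (hd z).differentiableAt)
    (fun z => (hd z).deriv) z 0
  have h0 : scaledCF 0 = 1000 := by
    simp [scaledCF, normalCF]
    norm_num
  rw [logCF_zero, neg_zero, Complex.exp_zero, mul_one, h0, Complex.exp_neg] at hc
  have := Complex.exp_ne_zero (logCF z)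
  field_simp at hc
  rw [eq_div_iff (by norm_num), hc, mul_comm]

theorem logDerivCF_neg (z : ℝ) : logDerivCF (-z) = -(starRingEnd ℂ) (logDerivCF z) := by
  rw [logDerivCF, logDerivCF, scaledCF_neg, normalCF_neg]
  simp only [map_div₀, map_mul, map_sub, Complex.conj_I, Complex.conj_ofReal, map_ofNat,
    Complex.ofReal_neg]
  ring

theorem logCF_neg (z : ℝ) : logCF (-z) = (starRingEnd ℂ) (logCF z) := by
  have hd : ∀ z, HasDerivAt (fun z => logCF (-z) - (starRingEnd ℂ) (logCF z)) 0 z := by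
    intro z
    have h1 := (hasDerivAt_logCF (-z)).scomp z (hasDerivAt_neg z)
    have h2 := Complex.conjCLE.toContinuousLinearMap.hasFDerivAt.comp_hasDerivAt z
      (hasDerivAt_logCF z)
    refine (h1.sub h2).congr_deriv ?_
    rw [logDerivCF_neg]
    simp
  have hc := is_const_of_deriv_eq_zero (fun z => (hd z).differentiableAt)
    (fun z => (hd z).deriv) z 0
  rw [neg_zero, logCF_zero, map_zero, sub_zero] at hc
  exact sub_eq_zero.1 hc

/-- The half-planes that `F` runs through are read off from the sine and cosine of its argument. -/
theorem cos_logCF_im_pos_iff (z : ℝ) : 0 < Real.cos (logCF z).im ↔ 0 < (scaledCF z).re := by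
  have h := congrArg Complex.re (exp_logCF z)
  rw [Complex.exp_re, Complex.div_ofNat_re] at h
  rw [← mul_pos_iff_of_pos_left (Real.exp_pos (logCF z).re), h]
  constructor <;> intro h' <;> linarith

theorem sin_logCF_im (z : ℝ) :
    Real.sin (logCF z).im =
      999 / 1000 * Real.exp (-z ^ 2 / 2) / Real.exp (logCF z).re * Real.sin z := by
  have h := congrArg Complex.im (exp_logCF z)
  rw [Complex.exp_im, Complex.div_ofNat_im, scaledCF_im] at h
  have := (Real.exp_pos (logCF z).re).ne'
  rw [div_mul_eq_mul_div, eq_div_iff this]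
  linarith

/-! ### The winding of the characteristic function -/

/-- An argument that starts in the half-plane around `θ` stays in it. -/
theorem abs_sub_lt_pi_div_two {g : ℝ → ℝ} {S : Set ℝ} (hS : IsPreconnected S)
    (hg : Continuous g) {θ : ℝ} (h : ∀ z ∈ S, 0 < Real.cos (g z - θ)) {c : ℝ} (hc : c ∈ S)
    (hcθ : |g c - θ| < Real.pi / 2) {z : ℝ} (hz : z ∈ S) : |g z - θ| < Real.pi / 2 := by
  by_contra! hcon
  obtain ⟨w, hw, hw'⟩ := hS.intermediate_value hc hz
    (f := fun z => |g z - θ|) (by fun_prop) ⟨hcθ.le, hcon⟩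
  have h1 := h w hw
  simp only at hw'
  rw [← Real.cos_abs, hw', Real.cos_pi_div_two] at h1
  exact lt_irrefl _ h1

/-- On `[0, π]` the characteristic function runs through the upper half-plane. -/
theorem logCF_im_pi : (logCF Real.pi).im = Real.pi := by
  have hπ := Real.pi_pos
  have hgc : Continuous fun z => (logCF z).im := Complex.continuous_im.comp continuous_logCF
  have hsin : ∀ z ∈ Set.Ioo 0 Real.pi, 0 < Real.sin (logCF z).im := by
    intro z hz
    rw [sin_logCF_im]
    have := Real.sin_pos_of_pos_of_lt_pi hz.1 hz.2
    positivity
  have hmem : Real.pi / 2 ∈ Set.Ioo 0 Real.pi := ⟨by linarith, by linarith⟩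
  have hA : |(logCF (Real.pi / 2)).im - 0| < Real.pi / 2 := by
    refine abs_sub_lt_pi_div_two (S := Set.Icc 0 (Real.pi / 2)) isPreconnected_Icc hgc
      (fun z hz => ?_) (c := 0) ⟨le_rfl, by linarith⟩ ?_ ⟨by linarith, le_rfl⟩
    · rw [sub_zero, cos_logCF_im_pos_iff, scaledCF_re]
      have := Real.cos_nonneg_of_neg_pi_div_two_le_of_le (x := z) (by linarith [hz.1]) hz.2
      positivity
    · rw [logCF_zero]
      simpa using hπ
  have hB : ∀ z ∈ Set.Ioo 0 Real.pi, (logCF z).im ∈ Set.Icc 0 Real.pi := by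
    intro z hz
    have h := abs_sub_lt_pi_div_two (θ := Real.pi / 2) isPreconnected_Ioo hgc
      (fun z hz => ?_) hmem ?_ hz
    · rw [abs_lt] at h
      exact ⟨by linarith [h.1], by linarith [h.2]⟩
    · rw [Real.cos_sub_pi_div_two]
      exact hsin z hz
    · rw [sub_zero, abs_lt] at hA
      have h0 : 0 < (logCF (Real.pi / 2)).im := by
        by_contra! h0
        exact (hsin _ hmem).not_ge (Real.sin_nonpos_of_nonpos_of_neg_pi_le h0 (by linarith))
      rw [abs_lt]
      exact ⟨by linarith, by linarith⟩
  have hπmem : (logCF Real.pi).im ∈ Set.Icc 0 Real.pi := by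
    have hne : (𝓝[<] Real.pi).NeBot := inferInstance
    refine isClosed_Icc.mem_of_tendsto (hgc.continuousWithinAt (s := Set.Iio Real.pi)) ?_
    filter_upwards [Ioo_mem_nhdsLT hπ] with z hz using hB z hz
  have hcos : ¬ 0 < Real.cos (logCF Real.pi).im := by
    rw [cos_logCF_im_pos_iff]
    exact scaledCF_pi_re_neg.not_gt
  have hs : Real.sin (logCF Real.pi).im = 0 := by rw [sin_logCF_im, Real.sin_pi, mul_zero]
  rcases hπmem.1.eq_or_lt with h0 | h0
  · rw [← h0, Real.cos_zero] at hcos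
    exact absurd one_pos hcos
  · rcases hπmem.2.eq_or_lt with h1 | h1
    · exact h1
    · exact absurd hs (Real.sin_pos_of_pos_of_lt_pi h0 h1).ne'

/-- On `[π, 2π]` the characteristic function returns through the lower half-plane, and from then
on it stays in the right one. -/
theorem abs_logCF_im_sub_two_pi_lt {z : ℝ} (hz : 3 * Real.pi / 2 ≤ z) :
    |(logCF z).im - 2 * Real.pi| < Real.pi / 2 := by
  have hπ := Real.pi_pos
  have hgc : Continuous fun z => (logCF z).im := Complex.continuous_im.comp continuous_logCF
  have hsin : ∀ z ∈ Set.Ioo Real.pi (2 * Real.pi), Real.sin (logCF z).im < 0 := by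
    intro z hz
    rw [sin_logCF_im]
    have := Real.sin_pos_of_pos_of_lt_pi (x := z - Real.pi) (by linarith [hz.1])
      (by linarith [hz.2])
    rw [Real.sin_sub_pi] at this
    refine mul_neg_of_pos_of_neg (by positivity) (by linarith)
  have hre : ∀ z ∈ Set.Ici (3 * Real.pi / 2), 0 < (scaledCF z).re := by
    intro z hz
    have h4 : 4 ≤ z := by linarith [Set.mem_Ici.1 hz, Real.pi_gt_three]
    exact scaledCF_re_pos_of_four_le (h4.trans (le_abs_self z))
  -- Just after `π` the argument is close to `π`, and its sine is negative, so it has increased.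
  obtain ⟨c, hc, hcπ⟩ : ∃ c ∈ Set.Ioo Real.pi (2 * Real.pi),
      |(logCF c).im - Real.pi| < Real.pi / 2 := by
    have h1 : ∀ᶠ c in 𝓝 Real.pi, |(logCF c).im - Real.pi| < Real.pi / 2 := by
      have hcont : Continuous fun c => |(logCF c).im - Real.pi| := by fun_prop
      refine hcont.continuousAt.eventually_lt continuousAt_const ?_
      rw [logCF_im_pi, sub_self, abs_zero]
      linarith
    have h2 := (h1.filter_mono nhdsWithin_le_nhds).and
      (Ioo_mem_nhdsGT (show Real.pi < 2 * Real.pi by linarith))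
    obtain ⟨c, h3, h4⟩ := h2.exists
    exact ⟨c, h4, h3⟩
  have hcoarse : |(logCF (3 * Real.pi / 2)).im - (Real.pi + Real.pi / 2)| < Real.pi / 2 := by
    refine abs_sub_lt_pi_div_two (S := Set.Ioo Real.pi (2 * Real.pi)) isPreconnected_Ioo hgc
      (fun z hz => ?_) hc ?_ ⟨by linarith, by linarith⟩
    · rw [← sub_sub, Real.cos_sub_pi_div_two, Real.sin_sub_pi]
      linarith [hsin z hz]
    · rw [abs_lt] at hcπ
      have h0 : Real.pi < (logCF c).im := by
        by_contra! h0
        exact (hsin c hc).not_ge (Real.sin_nonneg_of_nonneg_of_le_pi (by linarith) h0)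
      rw [abs_lt]
      exact ⟨by linarith, by linarith⟩
  refine abs_sub_lt_pi_div_two isPreconnected_Ici hgc (fun z hz => ?_) Set.self_mem_Ici ?_ hz
  · rw [Real.cos_sub_two_pi, cos_logCF_im_pos_iff]
    exact hre z hz
  · rw [abs_lt] at hcoarse
    have h0 : 3 * Real.pi / 2 < (logCF (3 * Real.pi / 2)).im := by
      by_contra! h0
      have h1 := (cos_logCF_im_pos_iff _).2 (hre _ Set.self_mem_Ici)
      have h2 := Real.cos_nonneg_of_neg_pi_div_two_le_of_le
        (x := (logCF (3 * Real.pi / 2)).im - Real.pi) (by linarith) (by linarith)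
      rw [Real.cos_sub_pi] at h2
      linarith
    rw [abs_lt]
    exact ⟨by linarith, by linarith⟩

theorem tendsto_scaledCF_atTop : Tendsto scaledCF atTop (𝓝 1) := by
  have h : Tendsto normalCF atTop (𝓝 0) := by
    rw [tendsto_zero_iff_norm_tendsto_zero]
    simp only [norm_normalCF]
    refine Real.tendsto_exp_atBot.comp ?_
    simp only [neg_div]
    exact tendsto_neg_atTop_atBot.comp ((tendsto_pow_atTop two_ne_zero).atTop_div_const two_pos)
  have h1 := (h.const_mul 999).const_add 1
  rwa [mul_zero, add_zero] at h1

theorem tendsto_logCF_atTop :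
    Tendsto logCF atTop (𝓝 (Complex.log (1 / 1000) + 2 * Real.pi * Complex.I)) := by
  have h : Tendsto (fun z => Complex.log (scaledCF z / 1000)) atTop
      (𝓝 (Complex.log (1 / 1000))) :=
    (tendsto_scaledCF_atTop.div_const 1000).clog (by
      rw [show (1 / 1000 : ℂ) = ((1 / 1000 : ℝ) : ℂ) by norm_num,
        Complex.ofReal_mem_slitPlane]
      norm_num)
  refine (h.add_const (2 * Real.pi * Complex.I)).congr' ?_
  filter_upwards [eventually_ge_atTop (3 * Real.pi / 2)] with z hz
  have h1 := abs_lt.1 (abs_logCF_im_sub_two_pi_lt hz)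
  have h2 : (logCF z - 2 * Real.pi * Complex.I).im = (logCF z).im - 2 * Real.pi := by simp
  have h3 := Complex.log_exp (x := logCF z - 2 * Real.pi * Complex.I)
    (by rw [h2]; linarith [Real.pi_pos]) (by rw [h2]; linarith [Real.pi_pos])
  -- Beyond `3π/2` the principal logarithm lags behind `logCF` by one turn.
  rw [Complex.exp_periodic.sub_eq, exp_logCF] at h3
  rw [h3, sub_add_cancel]

theorem tendsto_logCF_im_atTop : Tendsto (fun z => (logCF z).im) atTop (𝓝 (2 * Real.pi)) := by
  have h := (Complex.continuous_im.tendsto _).comp tendsto_logCF_atTop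
  have h1 : (Complex.log (1 / 1000) + 2 * Real.pi * Complex.I).im = 2 * Real.pi := by
    rw [show (1 / 1000 : ℂ) = ((1 / 1000 : ℝ) : ℂ) by norm_num,
      ← Complex.ofReal_log (by norm_num), Complex.add_im, Complex.ofReal_im, zero_add]
    simp
  rwa [h1] at h

theorem exists_abs_logCF_re_le : ∃ C, ∀ z, |(logCF z).re| ≤ C := by
  have hc : Continuous fun z => |(logCF z).re| :=
    (Complex.continuous_re.comp continuous_logCF).abs
  have h := ((Complex.continuous_re.tendsto _).comp tendsto_logCF_atTop).abs
  obtain ⟨M, hM⟩ := (eventually_atTop.1 (h.eventually_le_const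
    (lt_add_one _)))
  obtain ⟨K, hK⟩ := (isCompact_Icc (a := (0 : ℝ)) (b := M)).bddAbove_image hc.continuousOn
  have hpos : ∀ z, 0 ≤ z → |(logCF z).re| ≤
      max (|(Complex.log (1 / 1000) + 2 * Real.pi * Complex.I).re| + 1) K := by
    intro z hz
    rcases le_total z M with h1 | h1
    · exact (hK (Set.mem_image_of_mem _ ⟨hz, h1⟩)).trans (le_max_right _ _)
    · exact (hM z h1).trans (le_max_left _ _)
  refine ⟨max (|(Complex.log (1 / 1000) + 2 * Real.pi * Complex.I).re| + 1) K, fun z => ?_⟩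
  rcases le_total 0 z with hz | hz
  · exact hpos z hz
  · have := hpos (-z) (by linarith)
    rwa [logCF_neg, Complex.conj_re] at this

theorem hasIndex_charFun_exampleMeasure : HasIndex (charFun exampleMeasure) 2 := by
  refine ⟨fun x => ?_, fun z => (logCF z).im, -(2 * Real.pi), 2 * Real.pi,
    Complex.continuous_im.comp continuous_logCF, fun x => ?_, ?_, tendsto_logCF_im_atTop, ?_⟩
  · rw [charFun_exampleMeasure]
    exact div_ne_zero (scaledCF_ne_zero x) (by norm_num)
  · rw [charFun_exampleMeasure, ← exp_logCF, Complex.norm_exp, Complex.ofReal_exp,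
      ← Complex.exp_sub]
    congr 1
    apply Complex.ext <;> simp
  · have h := (tendsto_logCF_im_atTop.comp tendsto_neg_atBot_atTop).neg
    refine h.congr fun z => ?_
    simp [logCF_neg]
  · have := Real.pi_ne_zero
    push_cast
    field_simp
    ring

/-! ### Fourier transforms of twice differentiable functions -/

open FourierTransform in
theorem continuous_fourier_of_integrable {f : ℝ → ℂ} (hf : Integrable f) : Continuous (𝓕 f) := by
  have h : 𝓕 f = fun w : ℝ =>
      ∫ v : ℝ, Complex.exp ((-2 * Real.pi * v * w : ℝ) * Complex.I) • f v := by
    ext w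
    exact Real.fourier_real_eq_integral_exp_smul f w
  rw [h]
  refine continuous_of_dominated (bound := fun v => ‖f v‖) (fun w => ?_)
    (fun w => ae_of_all _ fun v => ?_) hf.norm (ae_of_all _ fun v => by fun_prop)
  · have hc : Continuous fun v : ℝ =>
        Complex.exp ((-2 * Real.pi * v * w : ℝ) * Complex.I) := by fun_prop
    exact hc.aestronglyMeasurable.smul hf.1
  · rw [norm_smul, Complex.norm_exp_ofReal_mul_I, one_mul]

open FourierTransform in
theorem norm_fourier_le_integral_norm (f : ℝ → ℂ) (w : ℝ) : ‖𝓕 f w‖ ≤ ∫ v, ‖f v‖ := by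
  rw [Real.fourier_real_eq_integral_exp_smul]
  refine (norm_integral_le_integral_norm _).trans (le_of_eq ?_)
  simp only [norm_smul, Complex.norm_exp_ofReal_mul_I, one_mul]

open FourierTransform in
/-- The Fourier transform of a function with two integrable derivatives is `O(1 / (1 + w²))`. -/
theorem integrable_fourier_of_hasDerivAt {f f' f'' : ℝ → ℂ} (h1 : ∀ x, HasDerivAt f (f' x) x)
    (h2 : ∀ x, HasDerivAt f' (f'' x) x) (hf : Integrable f) (hf' : Integrable f')
    (hf'' : Integrable f'') : Integrable (𝓕 f) := by
  have e1 : deriv f = f' := funext fun x => (h1 x).deriv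
  have e2 : deriv f' = f'' := funext fun x => (h2 x).deriv
  have k1 := Real.fourier_deriv hf (fun x => (h1 x).differentiableAt) (by rwa [e1])
  have k2 := Real.fourier_deriv hf' (fun x => (h2 x).differentiableAt) (by rwa [e2])
  rw [e1] at k1
  rw [e2] at k2
  refine (integrable_inv_one_add_sq.const_mul ((∫ v, ‖f v‖) + ∫ v, ‖f'' v‖)).mono'
    (continuous_fourier_of_integrable hf).aestronglyMeasurable (ae_of_all _ fun w => ?_)
  rw [← div_eq_mul_inv, le_div_iff₀ (by positivity)]
  have b1 := norm_fourier_le_integral_norm f w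
  have b2 := norm_fourier_le_integral_norm f'' w
  rw [congrFun k2 w, congrFun k1 w] at b2
  have hn : ‖(2 * Real.pi * Complex.I * w : ℂ)‖ = 2 * Real.pi * |w| := by
    simp [abs_of_pos Real.pi_pos]
  rw [norm_smul, norm_smul, hn] at b2
  have h3 : |w| ≤ 2 * Real.pi * |w| :=
    le_mul_of_one_le_left (abs_nonneg _) (by linarith [Real.pi_gt_three])
  have h4 : w ^ 2 * ‖𝓕 f w‖ ≤ 2 * Real.pi * |w| * (2 * Real.pi * |w| * ‖𝓕 f w‖) := by
    rw [← sq_abs, sq, mul_assoc]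
    gcongr
  nlinarith

/-! ### The density in the Fourier representation of the logarithmic derivative -/

/-- `1 - 1 / F`, where `F` is `scaledCF`: the factor of Gaussian decay in the logarithmic
derivative. -/
noncomputable def gaussPart (z : ℝ) : ℂ := 999 * normalCF z / scaledCF z

theorem continuous_gaussPart : Continuous gaussPart := by
  unfold gaussPart
  have := continuous_normalCF
  exact Continuous.div (by fun_prop) continuous_scaledCF scaledCF_ne_zero

theorem logDerivCF_eq (z : ℝ) : logDerivCF z = (Complex.I - z) * gaussPart z := by
  rw [logDerivCF, gaussPart]
  ring

theorem hasDerivAt_gaussPart (z : ℝ) :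
    HasDerivAt gaussPart ((Complex.I - z) * gaussPart z * (1 - gaussPart z)) z := by
  have h := ((hasDerivAt_normalCF z).const_mul 999).div (hasDerivAt_scaledCF z)
    (scaledCF_ne_zero z)
  refine h.congr_deriv ?_
  have := scaledCF_ne_zero z
  rw [gaussPart]
  field_simp

theorem hasDerivAt_I_sub (z : ℝ) : HasDerivAt (fun z : ℝ => Complex.I - (z : ℂ)) (-1) z :=
  (Complex.ofRealCLM.hasDerivAt (x := z)).const_sub Complex.I

theorem exists_norm_gaussPart_le :
    ∃ K, 0 ≤ K ∧ ∀ z, ‖gaussPart z‖ ≤ K * Real.exp (-z ^ 2 / 2) := by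
  obtain ⟨C, hC⟩ := exists_abs_logCF_re_le
  refine ⟨999 / 1000 * Real.exp C, by positivity, fun z => ?_⟩
  have h : scaledCF z = 1000 * Complex.exp (logCF z) := by
    rw [exp_logCF]
    ring
  rw [gaussPart, norm_div, norm_mul, norm_normalCF, h, norm_mul, Complex.norm_exp]
  have h1 : Real.exp (-C) ≤ Real.exp (logCF z).re := Real.exp_le_exp.2 (abs_le.1 (hC z)).1
  simp only [Complex.norm_ofNat]
  rw [div_le_iff₀ (by positivity)]
  have h2 : 1 ≤ Real.exp C * Real.exp (logCF z).re := by
    rw [← Real.exp_add, Real.one_le_exp_iff]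
    linarith [(abs_le.1 (hC z)).1]
  have h3 := Real.exp_pos (-z ^ 2 / 2)
  nlinarith

theorem integrable_of_norm_le_gaussian {f : ℝ → ℂ} (hf : Continuous f) {C : ℝ}
    (h : ∀ z, ‖f z‖ ≤ C * Real.exp (-z ^ 2 / 4)) : Integrable f := by
  have hi : Integrable fun z : ℝ => Real.exp (-z ^ 2 / 4) := by
    refine (integrable_exp_neg_mul_sq (show (0 : ℝ) < 1 / 4 by norm_num)).congr
      (ae_of_all _ fun z => ?_)
    change Real.exp _ = Real.exp _
    congr 1
    ring
  exact (hi.const_mul C).mono' hf.aestronglyMeasurable (ae_of_all _ h)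

/-- Half of the Gaussian exponent absorbs the powers of `i - z` that occur in the first two
derivatives of `logDerivCF`. -/
theorem norm_I_sub_pow_mul_exp_le (z : ℝ) {k : ℕ} (hk : k ≤ 4) :
    ‖Complex.I - (z : ℂ)‖ ^ k * Real.exp (-z ^ 2 / 2) ≤ 64 * Real.exp (-z ^ 2 / 4) := by
  have hsq : ‖Complex.I - (z : ℂ)‖ ^ 2 = 1 + z ^ 2 := by
    rw [← Complex.normSq_eq_norm_sq, Complex.normSq_apply]
    simp
    ring
  have h1 : 1 ≤ ‖Complex.I - (z : ℂ)‖ := by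
    rw [← one_le_sq_iff₀ (norm_nonneg _), hsq]
    nlinarith
  have h2 : 1 + z ^ 2 ≤ 8 * Real.exp (z ^ 2 / 8) := by
    nlinarith [Real.add_one_le_exp (z ^ 2 / 8)]
  calc ‖Complex.I - (z : ℂ)‖ ^ k * Real.exp (-z ^ 2 / 2)
      ≤ ‖Complex.I - (z : ℂ)‖ ^ 4 * Real.exp (-z ^ 2 / 2) := by
        gcongr
    _ = (1 + z ^ 2) ^ 2 * Real.exp (-z ^ 2 / 2) := by rw [← hsq]; ring
    _ ≤ (8 * Real.exp (z ^ 2 / 8)) ^ 2 * Real.exp (-z ^ 2 / 2) := by gcongr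
    _ = 64 * Real.exp (-z ^ 2 / 4) := by
        rw [mul_pow, ← Real.exp_nat_mul, mul_assoc, ← Real.exp_add]
        norm_num
        ring

theorem integrable_pow_mul_gaussPart_mul {k : ℕ} (hk : k ≤ 4) {h : ℝ → ℂ} (hc : Continuous h)
    {B : ℝ} (hB : ∀ z, ‖h z‖ ≤ B) :
    Integrable fun z : ℝ => (Complex.I - (z : ℂ)) ^ k * gaussPart z * h z := by
  obtain ⟨K, hK, hle⟩ := exists_norm_gaussPart_le
  have hB0 : 0 ≤ B := (norm_nonneg _).trans (hB 0)
  have hg := continuous_gaussPart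
  refine integrable_of_norm_le_gaussian (C := 64 * K * B) (by fun_prop) fun z => ?_
  rw [norm_mul, norm_mul, norm_pow]
  calc ‖Complex.I - (z : ℂ)‖ ^ k * ‖gaussPart z‖ * ‖h z‖
      ≤ ‖Complex.I - (z : ℂ)‖ ^ k * (K * Real.exp (-z ^ 2 / 2)) * B := by
        gcongr
        · exact hle z
        · exact hB z
    _ = ‖Complex.I - (z : ℂ)‖ ^ k * Real.exp (-z ^ 2 / 2) * (K * B) := by ring
    _ ≤ 64 * Real.exp (-z ^ 2 / 4) * (K * B) := by
        exact mul_le_mul_of_nonneg_right (norm_I_sub_pow_mul_exp_le z hk) (by positivity)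
    _ = _ := by ring

theorem integrable_logDerivCF : Integrable logDerivCF := by
  refine (integrable_pow_mul_gaussPart_mul (k := 1) (by norm_num) (h := fun _ => 1)
    continuous_const (B := 1) (by simp)).congr (ae_of_all _ fun z => ?_)
  simp [logDerivCF_eq]

open FourierTransform in
theorem integrable_fourier_logDerivCF : Integrable (𝓕 logDerivCF) := by
  obtain ⟨K, hK, hle⟩ := exists_norm_gaussPart_le
  have hg := continuous_gaussPart
  have hbd : ∀ z, ‖gaussPart z‖ ≤ K := fun z =>
    (hle z).trans (mul_le_of_le_one_right hK (Real.exp_le_one_iff.2 (by nlinarith [sq_nonneg z])))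
  have hbd1 : ∀ z, ‖1 - gaussPart z‖ ≤ 1 + K := fun z =>
    (norm_sub_le _ _).trans (by rw [norm_one]; linarith [hbd z])
  have hbd2 : ∀ z, ‖1 - 2 * gaussPart z‖ ≤ 1 + 2 * K := fun z =>
    (norm_sub_le _ _).trans (by
      rw [norm_one, norm_mul, Complex.norm_ofNat]; linarith [hbd z])
  have hbd3 : ∀ z, ‖(1 - gaussPart z) * (1 - 2 * gaussPart z)‖ ≤ (1 + K) * (1 + 2 * K) :=
    fun z => by
      rw [norm_mul]
      exact mul_le_mul (hbd1 z) (hbd2 z) (norm_nonneg _) (by linarith)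
  -- With `w = i - z` and `u = gaussPart z`, one has `w' = -1` and `u' = w u (1 - u)`.
  refine integrable_fourier_of_hasDerivAt
    (f' := fun z : ℝ => -gaussPart z +
      (Complex.I - (z : ℂ)) ^ 2 * gaussPart z * (1 - gaussPart z))
    (f'' := fun z : ℝ => (-3) * ((Complex.I - (z : ℂ)) ^ 1 * gaussPart z * (1 - gaussPart z)) +
      (Complex.I - (z : ℂ)) ^ 3 * gaussPart z * ((1 - gaussPart z) * (1 - 2 * gaussPart z)))
    (fun z => ?_) (fun z => ?_) integrable_logDerivCF (Integrable.add ?_ ?_) (Integrable.add ?_ ?_)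
  · rw [funext logDerivCF_eq]
    refine ((hasDerivAt_I_sub z).mul (hasDerivAt_gaussPart z)).congr_deriv ?_
    ring
  · have h := hasDerivAt_gaussPart z
    refine (h.neg.add ((((hasDerivAt_I_sub z).pow 2).mul h).mul (h.const_sub 1))).congr_deriv ?_
    simp only [Pi.pow_apply, Pi.mul_apply]
    push_cast
    ring
  · refine (integrable_pow_mul_gaussPart_mul (k := 0) (by norm_num) (h := fun _ => -1)
      continuous_const (B := 1) (by simp)).congr (ae_of_all _ fun z => ?_)
    simp
  · exact integrable_pow_mul_gaussPart_mul (by norm_num) (by fun_prop) hbd1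
  · exact (integrable_pow_mul_gaussPart_mul (by norm_num) (by fun_prop) hbd1).const_mul _
  · exact integrable_pow_mul_gaussPart_mul (by norm_num) (by fun_prop) hbd3

open FourierTransform in
/-- The density `q` with `-i ψ'(t) = ∫ e^{ixt} q(x) dx`, where `ψ` is the distinguished logarithm
`logCF`. The Fourier expression is real (`ofReal_fourierDensity`), so taking its real part loses
nothing. -/
noncomputable def fourierDensity (x : ℝ) : ℝ :=
  (-Complex.I * 𝓕 logDerivCF (x / (2 * Real.pi)) / (2 * Real.pi)).re

open FourierTransform in
/-- The Fourier transform of `ψ'` is imaginary since `ψ'(-z)` is the negative conjugate of `ψ'(z)`. -/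
theorem conj_fourier_logDerivCF (w : ℝ) :
    (starRingEnd ℂ) (𝓕 logDerivCF w) = -𝓕 logDerivCF w := by
  rw [Real.fourier_real_eq_integral_exp_smul, ← integral_conj, ← integral_neg_eq_self,
    ← integral_neg]
  refine integral_congr_ae (ae_of_all _ fun v => ?_)
  have h : (starRingEnd ℂ) (logDerivCF (-v)) = -logDerivCF v := by
    rw [logDerivCF_neg, map_neg, Complex.conj_conj]
  simp only [smul_eq_mul, map_mul, h, ← Complex.exp_conj, Complex.conj_I, Complex.conj_ofReal,
    mul_neg]
  congr 3
  push_cast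
  ring

open FourierTransform in
theorem ofReal_fourierDensity (x : ℝ) : (fourierDensity x : ℂ) =
    -Complex.I * 𝓕 logDerivCF (x / (2 * Real.pi)) / (2 * Real.pi) := by
  refine Complex.conj_eq_iff_re.1 ?_
  rw [map_div₀, map_mul, conj_fourier_logDerivCF, map_neg, map_mul, Complex.conj_I,
    Complex.conj_ofReal, map_ofNat, neg_neg, mul_neg, neg_mul]

theorem continuous_fourierDensity : Continuous fourierDensity := by
  unfold fourierDensity
  have := continuous_fourier_of_integrable integrable_logDerivCF
  fun_prop

theorem integrable_fourierDensity : Integrable fourierDensity := by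
  have h := integrable_fourier_logDerivCF.comp_div
    (show (2 * Real.pi) ≠ 0 by positivity)
  exact ((h.const_mul (-Complex.I)).div_const _).re

/-- Fourier inversion: `ψ'(t) = i ∫ e^{ixt} q(x) dx`. -/
theorem integral_exp_mul_fourierDensity (t : ℝ) :
    ∫ x : ℝ, Complex.I * Complex.exp (Complex.I * x * t) * fourierDensity x = logDerivCF t := by
  have hπ : (Real.pi : ℂ) ≠ 0 := Complex.ofReal_ne_zero.2 Real.pi_ne_zero
  have h := congrFun (continuous_logDerivCF.fourierInv_fourier_eq integrable_logDerivCF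
    integrable_fourier_logDerivCF) t
  rw [Real.fourierInv_eq'] at h
  have h2 := Measure.integral_comp_div (fun v : ℝ =>
    Complex.exp (((2 * Real.pi * inner ℝ v t : ℝ) : ℂ) * Complex.I) •
      FourierTransform.fourier logDerivCF v) (2 * Real.pi)
  rw [h, abs_of_pos (by positivity), Complex.real_smul] at h2
  have h3 : ∀ x : ℝ, Complex.I * Complex.exp (Complex.I * x * t) * fourierDensity x =
      (2 * Real.pi : ℂ)⁻¹ *
      (Complex.exp (((2 * Real.pi * inner ℝ (x / (2 * Real.pi)) t : ℝ) : ℂ) * Complex.I) •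
      FourierTransform.fourier logDerivCF (x / (2 * Real.pi))) := by
    intro x
    have h4 : ((2 * Real.pi * inner ℝ (x / (2 * Real.pi)) t : ℝ) : ℂ) * Complex.I =
        Complex.I * x * t := by
      have : 2 * Real.pi * inner ℝ (x / (2 * Real.pi)) t = x * t := by
        simp only [RCLike.inner_apply, conj_trivial]
        field_simp
      rw [this]
      push_cast
      ring
    rw [h4, ofReal_fourierDensity, smul_eq_mul]
    field_simp
    rw [Complex.I_sq]
    ring
  simp only [h3]
  rw [integral_const_mul, h2]
  push_cast
  field_simp

/-! ### The characteristic triplet of the example -/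

/-- The Lebesgue density `q(x) / x` of the quasi-Lévy measure of `exampleMeasure`; its value at
zero is irrelevant. -/
noncomputable def levyDensity (x : ℝ) : ℝ := fourierDensity x / x

theorem measurable_levyDensity : Measurable levyDensity :=
  continuous_fourierDensity.measurable.div measurable_id

theorem integrableOn_levyDensity (r : ℝ) (hr : 0 < r) :
    IntegrableOn levyDensity (Set.Ioo (-r) r)ᶜ := by
  refine Integrable.mono' ((integrable_fourierDensity.norm.const_mul r⁻¹).integrableOn)
    measurable_levyDensity.aestronglyMeasurable ?_
  filter_upwards [ae_restrict_mem measurableSet_Ioo.compl] with x hx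
  have h : r ≤ |x| := by
    by_contra! h
    exact hx (abs_lt.1 h)
  rw [levyDensity, norm_div, Real.norm_eq_abs x, div_eq_inv_mul]
  gcongr

/-- The quasi-Lévy measure of `exampleMeasure`. -/
noncomputable def levyMeasure : SignedMeasureAwayZero :=
  .ofDensity levyDensity integrableOn_levyDensity

theorem min_one_sq_mul_abs_levyDensity_le (x : ℝ) :
    min 1 (x ^ 2) * |levyDensity x| ≤ |fourierDensity x| := by
  rcases eq_or_ne x 0 with rfl | hx
  · simp
  · have h : min 1 (x ^ 2) ≤ |x| := by
      rcases le_total |x| 1 with h | h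
      · refine (min_le_right _ _).trans ?_
        rw [← sq_abs]
        nlinarith [abs_nonneg x]
      · exact (min_le_left _ _).trans h
    calc min 1 (x ^ 2) * |levyDensity x| ≤ |x| * |levyDensity x| := by gcongr
      _ = |fourierDensity x| := by rw [← abs_mul, levyDensity, mul_div_cancel₀ _ hx]

theorem isQuasiLevyType_levyMeasure : levyMeasure.IsQuasiLevyType := by
  have hm := measurable_levyDensity
  rw [SignedMeasureAwayZero.IsQuasiLevyType, levyMeasure,
    SignedMeasureAwayZero.totalVariation_ofDensity hm,
    lintegral_withDensity_eq_lintegral_mul _ (by fun_prop) (by fun_prop)]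
  refine lt_of_le_of_lt (lintegral_mono fun x => ?_) integrable_fourierDensity.abs.lintegral_lt_top
  rw [Pi.mul_apply, ← ENNReal.ofReal_mul (abs_nonneg _), mul_comm]
  exact ENNReal.ofReal_le_ofReal (min_one_sq_mul_abs_levyDensity_le x)

theorem integrable_lkIntegrand_mul_levyDensity (z : ℝ) :
    Integrable fun x => lkIntegrand z x * levyDensity x := by
  refine (integrable_fourierDensity.abs.const_mul (3 * z ^ 2 + 2)).mono'
    ((measurable_lkIntegrand z).mul
      (Complex.measurable_ofReal.comp measurable_levyDensity)).aestronglyMeasurable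
    (ae_of_all _ fun x => ?_)
  rw [norm_mul, Complex.norm_real, Real.norm_eq_abs]
  calc ‖lkIntegrand z x‖ * |levyDensity x|
      ≤ (3 * z ^ 2 + 2) * min 1 (x ^ 2) * |levyDensity x| := by
        gcongr
        exact norm_lkIntegrand_le z x
    _ = (3 * z ^ 2 + 2) * (min 1 (x ^ 2) * |levyDensity x|) := by ring
    _ ≤ _ := by
        gcongr
        exact min_one_sq_mul_abs_levyDensity_le x

/-- The Fourier representation of `ψ'` integrated over `[0, z]`, by Fubini's theorem. -/
theorem logCF_eq_integral (z : ℝ) : logCF z =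
    ∫ x : ℝ, (∫ t in (0 : ℝ)..z, Complex.I * Complex.exp (Complex.I * x * t)) *
      fourierDensity x := by
  simp only [logCF, ← integral_exp_mul_fourierDensity, ← intervalIntegral.integral_mul_const]
  refine intervalIntegral_integral_swap (f := fun t x : ℝ =>
    Complex.I * Complex.exp (Complex.I * x * t) * fourierDensity x) ?_
  have : IsFiniteMeasure (volume.restrict (Set.uIoc (0 : ℝ) z)) := by
    rw [Set.uIoc]
    infer_instance
  have hq := continuous_fourierDensity
  refine (integrable_fourierDensity.comp_snd (volume.restrict (Set.uIoc (0 : ℝ) z))).norm.mono'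
    (Continuous.aestronglyMeasurable (by unfold Function.uncurry; fun_prop))
    (ae_of_all _ fun p => ?_)
  have h : Complex.I * (p.2 : ℂ) * p.1 = ((p.2 * p.1 : ℝ) : ℂ) * Complex.I := by
    push_cast
    ring
  rw [Function.uncurry, h, norm_mul, norm_mul, Complex.norm_exp_ofReal_mul_I, Complex.norm_I,
    Complex.norm_real, one_mul, one_mul]

theorem integral_I_mul_exp {x : ℝ} (hx : x ≠ 0) (z : ℝ) :
    ∫ t in (0 : ℝ)..z, Complex.I * Complex.exp (Complex.I * x * t) =
      (Complex.exp (Complex.I * x * z) - 1) / x := by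
  have hx' : (x : ℂ) ≠ 0 := Complex.ofReal_ne_zero.2 hx
  rw [intervalIntegral.integral_const_mul,
    integral_exp_mul_complex (mul_ne_zero Complex.I_ne_zero hx')]
  rw [Complex.ofReal_zero, mul_zero, Complex.exp_zero]
  have := Complex.I_ne_zero
  field_simp

theorem isCharacteristicTriplet_exampleMeasure :
    IsCharacteristicTriplet exampleMeasure 0 (∫ x in Set.Icc (-1 : ℝ) 1, fourierDensity x)
      levyMeasure := by
  refine ⟨isQuasiLevyType_levyMeasure, fun z => ?_⟩
  rw [charFun_exampleMeasure, ← exp_logCF]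
  congr 1
  have hi : Integrable fun x => Complex.I * z *
      ((Set.Icc (-1 : ℝ) 1).indicator fourierDensity x : ℝ) :=
    ((integrable_fourierDensity.indicator measurableSet_Icc).ofReal).const_mul _
  rw [levyMeasure, SignedMeasureAwayZero.integral_ofDensity measurable_levyDensity
    integrableOn_levyDensity (measurable_lkIntegrand z) (integrable_lkIntegrand_mul_levyDensity z),
    ← integral_indicator measurableSet_Icc, ← integral_complex_ofReal, logCF_eq_integral]
  have hz : (-(1 / 2) * ((0 : ℝ) : ℂ) * (z : ℂ) ^ 2 : ℂ) = 0 := by simp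
  rw [hz, zero_add, mul_right_comm, ← integral_const_mul,
    ← integral_add hi (integrable_lkIntegrand_mul_levyDensity z)]
  -- Off zero, `(e^{ixz} - 1) q(x) / x` is the integrand plus the compensator, which becomes drift.
  refine integral_congr_ae ?_
  filter_upwards [Measure.ae_ne volume (0 : ℝ)] with x hx
  have hx' : (x : ℂ) ≠ 0 := Complex.ofReal_ne_zero.2 hx
  rw [integral_I_mul_exp hx, lkIntegrand, levyDensity]
  by_cases h1 : x ∈ Set.Icc (-1 : ℝ) 1
  · simp only [Set.indicator_of_mem h1]
    push_cast
    field_simp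
    ring
  · simp only [Set.indicator_of_notMem h1]
    push_cast
    field_simp
    ring

instance isProbabilityMeasure_exampleMeasure : IsProbabilityMeasure exampleMeasure := by
  refine ⟨?_⟩
  simp only [exampleMeasure, Measure.add_apply, Measure.smul_apply, measure_univ, smul_eq_mul,
    mul_one]
  rw [ENNReal.div_add_div_same, show (1 : ℝ≥0∞) + 999 = 1000 by norm_num]
  exact ENNReal.div_self (by simp) (by simp)

theorem exampleMeasure_singleton_zero_ne_zero : exampleMeasure {0} ≠ 0 := by
  simp only [exampleMeasure, Measure.add_apply, Measure.smul_apply, smul_eq_mul,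
    measurableSet_singleton, Measure.dirac_apply', Set.indicator_of_mem (Set.mem_singleton (0 : ℝ)),
    Pi.one_apply, mul_one]
  intro h
  have := (add_eq_zero.1 h).1
  simp at this

/-! ### The parts of every quasi-Lévy measure of the example are infinite -/

/-- Two continuous logarithms of the same function that agree at zero are equal: the imaginary part
of their difference has positive cosine, so it stays in `(-π/2, π/2)`. -/
theorem eq_of_exp_eq {f g : ℝ → ℂ} (hf : Continuous f) (hg : Continuous g)
    (h : ∀ z, Complex.exp (f z) = Complex.exp (g z)) (h0 : f 0 = g 0) : f = g := by
  have h1 : ∀ z, Complex.exp (f z - g z) = 1 := fun z => by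
    rw [Complex.exp_sub, h, div_self (Complex.exp_ne_zero _)]
  have hcos : ∀ z, 0 < Real.cos ((f z - g z).im - 0) := by
    intro z
    have h2 := congrArg Complex.re (h1 z)
    rw [Complex.exp_re, Complex.one_re] at h2
    rw [sub_zero]
    by_contra! hc
    linarith [mul_nonpos_of_nonneg_of_nonpos (Real.exp_pos (f z - g z).re).le hc]
  ext z
  have h3 := abs_sub_lt_pi_div_two isPreconnected_univ
    (g := fun z => (f z - g z).im) (Complex.continuous_im.comp (hf.sub hg)) (θ := 0)
    (fun z _ => hcos z) (Set.mem_univ 0) (by simp [h0, Real.pi_pos]) (Set.mem_univ z)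
  simp only [sub_zero, abs_lt] at h3
  have h4 := Complex.log_exp (x := f z - g z) (by linarith [Real.pi_pos])
    (by linarith [Real.pi_pos])
  rw [h1, Complex.log_one] at h4
  exact sub_eq_zero.1 h4.symm

theorem re_integral_lkIntegrand {P : Measure ℝ}
    (hP : ∫⁻ x : ℝ, ENNReal.ofReal (min 1 (x ^ 2)) ∂P < ∞) (z : ℝ) :
    (∫ x, lkIntegrand z x ∂P).re = -∫ x, (1 - Real.cos (x * z)) ∂P := by
  have h := Complex.reCLM.integral_comp_comm (integrable_lkIntegrand hP z)
  simp only [Complex.reCLM_apply, lkIntegrand_re] at h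
  rw [← h, integral_neg]

theorem im_integral_lkIntegrand {P : Measure ℝ} [IsFiniteMeasure P]
    (hP : ∫⁻ x : ℝ, ENNReal.ofReal (min 1 (x ^ 2)) ∂P < ∞) (z : ℝ) :
    (∫ x, lkIntegrand z x ∂P).im = (∫ x, Real.sin (x * z) ∂P) -
      z * ∫ x, (Set.Icc (-1 : ℝ) 1).indicator id x ∂P := by
  have h := Complex.imCLM.integral_comp_comm (integrable_lkIntegrand hP z)
  simp only [Complex.imCLM_apply, lkIntegrand_im] at h
  rw [← h, integral_sub, integral_const_mul]
  · exact (integrable_const (1 : ℝ)).mono' (by fun_prop)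
      (ae_of_all _ fun x => Real.abs_sin_le_one _)
  · refine Integrable.const_mul ((integrable_const (1 : ℝ)).mono'
      (measurable_id.indicator measurableSet_Icc).aestronglyMeasurable
      (ae_of_all _ fun x => ?_)) z
    by_cases hx : x ∈ Set.Icc (-1 : ℝ) 1
    · rw [Set.indicator_of_mem hx]
      exact abs_le.2 hx
    · rw [Set.indicator_of_notMem hx, norm_zero]
      exact zero_le_one

/-- The Lévy–Khintchine exponent of every triplet is the distinguished logarithm. -/
theorem exponent_eq_logCF {a γ : ℝ} {ν : SignedMeasureAwayZero}
    (hP : ∫⁻ x : ℝ, ENNReal.ofReal (min 1 (x ^ 2)) ∂ν.posPart < ∞)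
    (hN : ∫⁻ x : ℝ, ENNReal.ofReal (min 1 (x ^ 2)) ∂ν.negPart < ∞)
    (h : IsCharacteristicTriplet exampleMeasure a γ ν) (z : ℝ) :
    -(1 / 2) * a * (z : ℂ) ^ 2 + Complex.I * γ * z + ν.integral (lkIntegrand z) = logCF z := by
  refine congrFun (eq_of_exp_eq (f := fun z : ℝ => -(1 / 2) * a * (z : ℂ) ^ 2 +
    Complex.I * γ * z + ν.integral (lkIntegrand z)) ?_ continuous_logCF (fun z => ?_) ?_) z
  · have h1 := continuous_integral_lkIntegrand hP
    have h2 := continuous_integral_lkIntegrand hN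
    unfold SignedMeasureAwayZero.integral
    fun_prop
  · rw [← h.2 z, charFun_exampleMeasure, exp_logCF]
  · have h0 : ∀ x, lkIntegrand 0 x = 0 := fun x => by simp [lkIntegrand]
    simp [SignedMeasureAwayZero.integral, h0, logCF_zero]

/-- Both parts of the quasi-Lévy measure are infinite: if one is finite, so is the other, because
the characteristic function is bounded away from zero; and if both are finite, the index is zero. -/
theorem posPart_negPart_univ_eq_top {a γ : ℝ} {ν : SignedMeasureAwayZero}
    (h : IsCharacteristicTriplet exampleMeasure a γ ν) :
    ν.posPart Set.univ = ∞ ∧ ν.negPart Set.univ = ∞ := by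
  have hν := h.1
  rw [SignedMeasureAwayZero.IsQuasiLevyType, ν.totalVariation_eq_add, lintegral_add_measure,
    ENNReal.add_lt_top] at hν
  obtain ⟨hP, hN⟩ := hν
  obtain ⟨C, hC⟩ := exists_abs_logCF_re_le
  have hexp := exponent_eq_logCF hP hN h
  have hre : ∀ z, (logCF z).re = -(a / 2 * z ^ 2 +
      (∫ x, (1 - Real.cos (x * z)) ∂ν.posPart) - ∫ x, (1 - Real.cos (x * z)) ∂ν.negPart) := by
    intro z
    have h1 : (-(1 / 2) * a * (z : ℂ) ^ 2 + Complex.I * γ * z : ℂ) =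
        ((-(a / 2) * z ^ 2 : ℝ) : ℂ) + ((γ * z : ℝ) : ℂ) * Complex.I := by
      push_cast
      ring
    rw [← hexp z, h1, SignedMeasureAwayZero.integral, Complex.add_re, Complex.sub_re,
      re_integral_lkIntegrand hP, re_integral_lkIntegrand hN, Complex.add_re,
      Complex.ofReal_re, Complex.re_ofReal_mul, Complex.I_re]
    ring
  have hPN : IsFiniteMeasure ν.negPart → IsFiniteMeasure ν.posPart := by
    intro hfin
    refine isFiniteMeasure_of_abs_re_exponent_le (N := ν.negPart) hP ν.posPart_zero
      (a := a / 2) (C := C) fun z => ?_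
    rw [← abs_neg, ← hre z]
    exact hC z
  have hNP : IsFiniteMeasure ν.posPart → IsFiniteMeasure ν.negPart := by
    intro hfin
    refine isFiniteMeasure_of_abs_re_exponent_le (N := ν.posPart) hN ν.negPart_zero
      (a := -(a / 2)) (C := C) fun z => ?_
    refine le_trans (le_of_eq ?_) (hC z)
    rw [hre z]
    congr 1
    ring
  have hnot : ¬ (IsFiniteMeasure ν.posPart ∧ IsFiniteMeasure ν.negPart) := by
    rintro ⟨hPf, hNf⟩
    -- The compensator is integrable against finite measures and merges with the drift.
    set b : ℝ := γ - (∫ x, (Set.Icc (-1 : ℝ) 1).indicator id x ∂ν.posPart) +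
      ∫ x, (Set.Icc (-1 : ℝ) 1).indicator id x ∂ν.negPart with hb
    have him : ∀ z, (logCF z).im = b * z + (∫ x, Real.sin (x * z) ∂ν.posPart) -
        ∫ x, Real.sin (x * z) ∂ν.negPart := by
      intro z
      have h1 : (-(1 / 2) * a * (z : ℂ) ^ 2 + Complex.I * γ * z : ℂ) =
          ((-(a / 2) * z ^ 2 : ℝ) : ℂ) + ((γ * z : ℝ) : ℂ) * Complex.I := by
        push_cast
        ring
      rw [← hexp z, h1, SignedMeasureAwayZero.integral, Complex.add_im, Complex.sub_im,
        im_integral_lkIntegrand hP, im_integral_lkIntegrand hN, Complex.add_im,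
        Complex.ofReal_im, Complex.im_ofReal_mul, Complex.I_im, hb]
      ring
    have h2 := eq_zero_of_tendsto_im_exponent (tendsto_logCF_im_atTop.congr him)
    exact (by positivity : (2 * Real.pi) ≠ 0) h2
  have hfinite : ∀ M : Measure ℝ, M Set.univ ≠ ∞ → IsFiniteMeasure M :=
    fun M hM => ⟨hM.lt_top⟩
  constructor
  · by_contra hcon
    have h1 := hfinite _ hcon
    exact hnot ⟨h1, hNP h1⟩
  · by_contra hcon
    have h1 := hfinite _ hcon
    exact hnot ⟨hPN h1, h1⟩

theorem totalVariation_univ_eq_top {a γ : ℝ} {ν : SignedMeasureAwayZero}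
    (h : IsCharacteristicTriplet exampleMeasure a γ ν) : ν.totalVariation Set.univ = ∞ := by
  rw [ν.totalVariation_eq_add, Measure.add_apply, (posPart_negPart_univ_eq_top h).1, top_add]

end QuasiID

theorem mainTheorem8 :
    IsProbabilityMeasure QuasiID.exampleMeasure ∧
    -- the characteristic function, which has no zeroes and has index two
    (∀ z : ℝ, charFun QuasiID.exampleMeasure z =
      1 / 1000 + 999 / 1000 * Complex.exp (Complex.I * z) * Complex.exp (-(z : ℂ) ^ 2 / 2)) ∧
    (∀ z : ℝ, charFun QuasiID.exampleMeasure z ≠ 0) ∧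
    QuasiID.HasIndex (charFun QuasiID.exampleMeasure) 2 ∧
    -- quasi-infinite divisibility, and the quasi-Lévy measure
    QuasiID.IsQuasiInfinitelyDivisible QuasiID.exampleMeasure ∧
    (∀ (a γ : ℝ) (ν : QuasiID.SignedMeasureAwayZero),
      QuasiID.IsCharacteristicTriplet QuasiID.exampleMeasure a γ ν →
        ν.posPart Set.univ = ∞ ∧ ν.negPart Set.univ = ∞ ∧ ν.totalVariation Set.univ = ∞) ∧
    -- the measure is not continuous
    ¬ (∀ x : ℝ, QuasiID.exampleMeasure {x} = 0) ∧
    -- continuity is not equivalent to `a ≠ 0` or `|ν|(ℝ) = ∞`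
    ¬ (∀ (μ : Measure ℝ) (a γ : ℝ) (ν : QuasiID.SignedMeasureAwayZero),
      IsProbabilityMeasure μ → QuasiID.IsCharacteristicTriplet μ a γ ν →
        ((∀ x : ℝ, μ {x} = 0) ↔ a ≠ 0 ∨ ν.totalVariation Set.univ = ∞)) := by
  have htriplet := QuasiID.isCharacteristicTriplet_exampleMeasure
  refine ⟨inferInstance, fun z => ?_, QuasiID.hasIndex_charFun_exampleMeasure.1,
    QuasiID.hasIndex_charFun_exampleMeasure, ⟨inferInstance, _, _, _, htriplet⟩,
    fun a γ ν h => ⟨(QuasiID.posPart_negPart_univ_eq_top h).1,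
      (QuasiID.posPart_negPart_univ_eq_top h).2, QuasiID.totalVariation_univ_eq_top h⟩,
    fun h => QuasiID.exampleMeasure_singleton_zero_ne_zero (h 0), fun h => ?_⟩
  · rw [QuasiID.charFun_exampleMeasure, QuasiID.scaledCF, QuasiID.normalCF, mul_assoc,
      ← Complex.exp_add, neg_div, ← sub_eq_add_neg]
    ring
  · exact QuasiID.exampleMeasure_singleton_zero_ne_zero
      ((h _ _ _ _ inferInstance htriplet).2 (.inr (QuasiID.totalVariation_univ_eq_top htriplet)) 0)
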